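/- **Setting.** Let $\mathcal X$ be a measurable space, $\mu$ a probability measure on $\mathcal X\times\{-1,+1\}$ and $\mu^{\mathcal X}$ its marginal on $\mathcal X$. *Loss.* $\ell:\mathbb R\to[0,\infty)$ is convex, Lipschitz and twice continuously differentiable with $\ell''>0$ everywhere; $\ell'\ge 0$ everywhere; there is $\beta_1>0$ with $\ell'\ge\beta_1$ on $[0,\infty)$; and $\ell'$ is Lipschitz, with smallest Lipschitz constant $B_2$. (The logistic loss $\ln(1+e^z)$ is an example.) *Class.* $\mathcal H$ is a class of measurable functions $h:\mathcal X\to\{-1,+1\}$ of finite VC dimension whose linear span is dense, in the $L^1(\mu^{\mathcal X})$ distance, in the bounded measurable functions on $\mathcal X$ (every bounded measurable function is an $L^1(\mu^{\mathcal X})$-limit of elements of the span). *Notation.* For a finitely supported $\lambda:\mathcal H\to\mathbb R$ put $(H\lambda)(x)=\sum_h\lambda(h)h(x)$ and $(A\lambda)(x,y)=-y(H\lambda)(x)$, and let $\mathbf e_h$ be the unit weight on $h$. For a sample $(x_i,y_i)_{i\le m}$ let $\widehat{\mathcal L}(\lambda)=\frac1m\sum_i\ell((A\lambda)(x_i,y_i))$,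 with directional derivative $D\widehat{\mathcal L}(\lambda)[v]=\frac1m\sum_i\ell'((A\lambda)(x_i,y_i))\,(Av)(x_i,y_i)$. For $f:\mathcal X\to\mathbb R$ let $\mathcal R(f)=\mu\{(x,y): (y=+1,\ f(x)<0)\text{ or }(y=-1,\ f(x)\ge0)\}$, let $\widehat{\mathcal R}(f)$ be the analogous fraction of errors on the sample, and let $\mathcal R_\star=\inf_g\mu\{g(x)\ne y\}$ over measurable $g:\mathcal X\to\{-1,+1\}$ be the Bayes error rate. *Algorithm.* Fix $a,\rho\in(0,1)$. On a sample of size $m\ge1$, start from $\lambda_0=0$. In each round $t=1,\dots,T:=\lceil m^a\rceil$ choose $h_t\in\mathcal H$ with $$|D\widehat{\mathcal L}(\lambda_{t-1})[\mathbf e_{h_t}]|\ \ge\ \rho\,\sup_{h\in\mathcal H}|D\widehat{\mathcal L}(\lambda_{t-1})[\mathbf e_h]|,$$ choose $v_t\in\{\mathbf e_{h_t},-\mathbf e_{h_t}\}$ with $D\widehat{\mathcal L}(\lambda_{t-1})[v_t]\le0$, and set $\lambda_t=\lambda_{t-1}+\alpha_tv_t$, where $\alpha_t\ge0$ satisfies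 at least one of the following: 1. $\alpha_t$ minimizes $\alpha\mapsto\widehat{\mathcal L}(\lambda_{t-1}+\alpha v_t)$ over $\alpha\ge0$; 2. $-D\widehat{\mathcal L}(\lambda_{t-1})[v_t]/B_2\le\alpha_t<\bar\alpha_t$, where $\bar\alpha_t$ is a minimizer as in 1, or $\bar\alpha_t=\infty$ if there is none; 3. (Wolfe conditions) $\widehat{\mathcal L}(\lambda_{t-1}+\alpha_tv_t)\le\widehat{\mathcal L}(\lambda_{t-1})+\frac13\alpha_tD\widehat{\mathcal L}(\lambda_{t-1})[v_t]$ and $D\widehat{\mathcal L}(\lambda_{t-1}+\alpha_tv_t)[v_t]\ge\frac12D\widehat{\mathcal L}(\lambda_{t-1})[v_t]$. Return $\hat\lambda=\lambda_i$ for some $i\in\{1,\dots,T\}$ that minimizes $\widehat{\mathcal R}(H\lambda_i)$ over $\{1,\dots,T\}$. The choices (weak learner, sign, step size, returned index) may be made by any rule that obeys these requirements and is a measurable function of the sample (for the weak learner: $h_t(x)$ is jointly measurable in the sample and $x$). **Theorem.** Let $(X_i,Y_i)_{i\ge1}$ be i.i.d. with law $\mu$, and let $\hat\lambda_m$ be the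 output of the algorithm, run for $\lceil m^a\rceil$ rounds on $(X_i,Y_i)_{i\le m}$. Then $$\mathcal R(H\hat\lambda_m)\to\mathcal R_\star\qquad\text{almost surely as } m\to\infty.$$ -/

import Mathlib

open MeasureTheory ProbabilityTheory Filter Topology

noncomputable section

namespace Boosting

/-! ### Losses -/

/-- Convex, Lipschitz, differentiable losses `ℓ : ℝ → ℝ₊` with `ℓ' ≥ 0` everywhere,
`ℓ' ≥ β₁ > 0` on the nonnegative reals, and Lipschitz gradient.
(The upper bound of `ℓ'` by the Lipschitz constant of `ℓ` is automatic.) -/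
structure IsLbds (ℓ : ℝ → ℝ) : Prop where
  nonneg : ∀ z, 0 ≤ ℓ z
  convex : ConvexOn ℝ Set.univ ℓ
  differentiable : Differentiable ℝ ℓ
  lipschitz : ∃ K : NNReal, LipschitzWith K ℓ
  deriv_nonneg : ∀ z, 0 ≤ deriv ℓ z
  deriv_lower : ∃ β₁ : ℝ, 0 < β₁ ∧ ∀ z, 0 ≤ z → β₁ ≤ deriv ℓ z
  lipschitz_deriv : ∃ K : NNReal, LipschitzWith K (deriv ℓ)

/-- Twice continuously differentiable convex losses, with positive second derivative. -/
structure IsLtd (ℓ : ℝ → ℝ) : Prop where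
  convex : ConvexOn ℝ Set.univ ℓ
  contDiff : ContDiff ℝ 2 ℓ
  deriv2_pos : ∀ z, 0 < deriv (deriv ℓ) z

/-- The tightest Lipschitz constant `B₂` of `ℓ'`. For a convex loss with Lipschitz gradient the
set of slopes is bounded and nonnegative, so the pairs with `x = y` (slope `0`) do not matter. -/
def gradLip (ℓ : ℝ → ℝ) : ℝ :=
  ⨆ p : ℝ × ℝ, (deriv ℓ p.2 - deriv ℓ p.1) / (p.2 - p.1)

/-! ### Hypothesis classes -/

section

variable {X : Type*}

/-- A binary class: every member takes values in `{-1, +1}`. -/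
def IsBinary (H : Set (X → ℝ)) : Prop :=
  ∀ h ∈ H, ∀ x, h x = 1 ∨ h x = -1

/-- The binary class `H` shatters the finite set `s`. -/
def Shatters (H : Set (X → ℝ)) (s : Finset X) : Prop :=
  ∀ t ⊆ s, ∃ h ∈ H, ∀ x ∈ s, h x = 1 ↔ x ∈ t

/-- The binary class `H` has finite VC dimension. -/
def FiniteVC (H : Set (X → ℝ)) : Prop :=
  ∃ d : ℕ, ∀ s : Finset X, Shatters H s → s.card ≤ d

/-- The linear span of `H` is dense, for the `L¹(ν)` distance, in the bounded measurable
functions. -/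
def DenseSpan [MeasurableSpace X] (ν : Measure X) (H : Set (X → ℝ)) : Prop :=
  ∀ g : X → ℝ, Measurable g → (∃ C : ℝ, ∀ x, |g x| ≤ C) →
    ∀ ε : ENNReal, 0 < ε → ∃ f ∈ Submodule.span ℝ H, eLpNorm (fun x => f x - g x) 1 ν < ε

/-! ### Weightings, surrogate risk and classification risk

A labelled example is an element of `X × Bool`, where `true` stands for the label `+1` and `false`
for the label `-1`. -/

/-- The real number `+1` or `-1` named by a label. -/
def sgn (y : Bool) : ℝ := if y then 1 else -1

/-- `(H λ)(x) = ∑ₕ h(x) λ(h)`. -/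
def predictor (H : Set (X → ℝ)) (lam : H →₀ ℝ) (x : X) : ℝ :=
  lam.sum fun h c => (h : X → ℝ) x * c

/-- `(A λ)(x, y) = -y (H λ)(x)`. -/
def negMargin (H : Set (X → ℝ)) (lam : H →₀ ℝ) (z : X × Bool) : ℝ :=
  -(sgn z.2) * predictor H lam z.1

/-- The empirical surrogate risk of `λ` on the sample `S`. -/
def empLoss (H : Set (X → ℝ)) (ℓ : ℝ → ℝ) {m : ℕ} (S : Fin m → X × Bool) (lam : H →₀ ℝ) : ℝ :=
  (1 / (m : ℝ)) * ∑ i, ℓ (negMargin H lam (S i))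

/-- The derivative at `λ` of the empirical surrogate risk, in the direction `v`. -/
def empGrad (H : Set (X → ℝ)) (ℓ : ℝ → ℝ) {m : ℕ} (S : Fin m → X × Bool) (lam v : H →₀ ℝ) : ℝ :=
  (1 / (m : ℝ)) * ∑ i, deriv ℓ (negMargin H lam (S i)) * negMargin H v (S i)

/-- The classifier "predict `+1` iff `f x ≥ 0`" errs on the example `z`. -/
def Errs (f : X → ℝ) (z : X × Bool) : Prop :=
  (z.2 = true ∧ f z.1 < 0) ∨ (z.2 = false ∧ 0 ≤ f z.1)

open Classical in
/-- The empirical classification risk of `f` on the sample `S`. -/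
def empErr {m : ℕ} (S : Fin m → X × Bool) (f : X → ℝ) : ℝ :=
  (1 / (m : ℝ)) * ∑ i, if Errs f (S i) then (1 : ℝ) else 0

/-- The classification risk of `f`. -/
def risk [MeasurableSpace X] (μ : Measure (X × Bool)) (f : X → ℝ) : ℝ :=
  μ.real {z | Errs f z}

/-- The Bayes error rate: the infimum of the error over all measurable classifiers. -/
def bayesRisk [MeasurableSpace X] (μ : Measure (X × Bool)) : ℝ :=
  ⨅ g : {g : X → Bool // Measurable g}, μ.real {z | g.1 z.1 ≠ z.2}

/-! ### The algorithm -/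

/-- `α` is a minimizer of `φ` over the half line. The end point `0` is included in order to cover
the degenerate case of a zero slope at `0`; if `φ` has a negative slope at `0`, the minimizers
over `α > 0` and over `α ≥ 0` are the same. -/
def IsLineMin (φ : ℝ → ℝ) (α : ℝ) : Prop :=
  0 ≤ α ∧ ∀ β, 0 ≤ β → φ α ≤ φ β

/-- The weak learner `h` is a `ρ`-approximately best coordinate at `λ`. -/
def ApproxBest (H : Set (X → ℝ)) (ℓ : ℝ → ℝ) (ρ : ℝ) {m : ℕ} (S : Fin m → X × Bool)
    (lam : H →₀ ℝ) (h : H) : Prop :=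
  ρ * (⨆ h' : H, |empGrad H ℓ S lam (Finsupp.single h' 1)|)
    ≤ |empGrad H ℓ S lam (Finsupp.single h 1)|

/-- The three admissible kinds of step from `λ` in the direction `v`:
an optimal step; any step between the quadratic upper bound's step and an optimal step
(with no upper limit if there is no optimal step); a step satisfying the Wolfe conditions with
constants `1/3` and `1/2`. -/
def AdmissibleStep (H : Set (X → ℝ)) (ℓ : ℝ → ℝ) {m : ℕ} (S : Fin m → X × Bool)
    (lam v : H →₀ ℝ) (α : ℝ) : Prop :=
  0 ≤ α ∧
  (IsLineMin (fun s => empLoss H ℓ S (lam + s • v)) α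
  ∨ (-(empGrad H ℓ S lam v) / gradLip ℓ ≤ α ∧
      ((∃ αbar, IsLineMin (fun s => empLoss H ℓ S (lam + s • v)) αbar ∧ α < αbar)
        ∨ ¬ ∃ αbar, IsLineMin (fun s => empLoss H ℓ S (lam + s • v)) αbar))
  ∨ (empLoss H ℓ S (lam + α • v) ≤ empLoss H ℓ S lam + α * (1 / 3) * empGrad H ℓ S lam v ∧
      (1 / 2) * empGrad H ℓ S lam v ≤ empGrad H ℓ S (lam + α • v) v))

/-- The choices that an implementation of the algorithm makes on a sample `S` of size `m`:
the weak learner, the sign of the direction and the step size of every round (rounds are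
numbered from `0`), and the index of the iterate which is returned. -/
structure Choices (X : Type*) (H : Set (X → ℝ)) where
  weak : (m : ℕ) → (Fin m → X × Bool) → ℕ → H
  sign : (m : ℕ) → (Fin m → X × Bool) → ℕ → Bool
  step : (m : ℕ) → (Fin m → X × Bool) → ℕ → ℝ
  best : (m : ℕ) → (Fin m → X × Bool) → ℕ

variable {H : Set (X → ℝ)}

/-- The descent direction `± e_h` of round `t`. -/
def Choices.dir (C : Choices X H) (m : ℕ) (S : Fin m → X × Bool) (t : ℕ) : H →₀ ℝ :=
  Finsupp.single (C.weak m S t) (sgn (C.sign m S t))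

/-- The iterate after `t` rounds. -/
def Choices.iterate (C : Choices X H) (m : ℕ) (S : Fin m → X × Bool) : ℕ → (H →₀ ℝ)
  | 0 => 0
  | t + 1 => C.iterate m S t + C.step m S t • C.dir m S t

/-- The weighting that is returned. -/
def Choices.output (C : Choices X H) (m : ℕ) (S : Fin m → X × Bool) : H →₀ ℝ :=
  C.iterate m S (C.best m S)

/-- On the sample `S` the choices are those of a run of the boosting algorithm with `T` rounds. -/
structure Choices.IsRun (C : Choices X H) (ℓ : ℝ → ℝ) (ρ : ℝ) (T m : ℕ)
    (S : Fin m → X × Bool) : Prop where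
  weak_approx : ∀ t < T, ApproxBest H ℓ ρ S (C.iterate m S t) (C.weak m S t)
  descent : ∀ t < T, empGrad H ℓ S (C.iterate m S t) (C.dir m S t) ≤ 0
  step_admissible : ∀ t < T,
    AdmissibleStep H ℓ S (C.iterate m S t) (C.dir m S t) (C.step m S t)
  one_le_best : 1 ≤ C.best m S
  best_le : C.best m S ≤ T
  best_min : ∀ i, 1 ≤ i → i ≤ T →
    empErr S (predictor H (C.output m S)) ≤ empErr S (predictor H (C.iterate m S i))

/-- The choices depend on the sample in a measurable way. -/
structure Choices.IsMeasurable [MeasurableSpace X] (C : Choices X H) : Prop where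
  weak : ∀ m t, Measurable fun p : (Fin m → X × Bool) × X => (C.weak m p.1 t : X → ℝ) p.2
  sign : ∀ m t, Measurable fun S : Fin m → X × Bool => C.sign m S t
  step : ∀ m t, Measurable fun S : Fin m → X × Bool => C.step m S t
  best : ∀ m, Measurable fun S : Fin m → X × Bool => C.best m S

end

end Boosting

end

/-!
The output minimizes the empirical classification error over the iterates, and the run is so short
(`⌈m ^ a⌉` rounds with `a < 1`) that empirical and true frequencies of the events defined by
iterates are uniformly close. So it suffices to find, for every `ε > 0` and all large samples, one
iterate whose empirical classification error is at most the Bayes risk plus `ε`.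

*Optimization.* Every admissible step decreases the empirical surrogate risk by a multiple of the
squared slope, hence the squared slopes are summable with a fixed bound. The steps themselves may
be long compared with the slopes, and then nothing bounds the iterates. But if all iterates have
empirical error above `ε`, then at each of them a fixed fraction of the sample has negative margin
in a fixed interval `[0, M]`: the errors have nonnegative negative margin, and large values of it
are rare because the risk is at most its initial value. Since the hypotheses are `±1`-valued, each
of these examples contributes the curvature of the loss on `[-1, M + 1]` along the direction of the
step, both at the beginning and at the end of it, and therefore the step is at most a constant
times the slope. By convexity, a gap to a competitor forces the slope of round `t` to be at least
of order `1 / √t`, and the divergence of the harmonic series closes the gap in a number of rounds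
that depends neither on the sample nor on its size. This dichotomy, either an iterate with error at
most `ε` or a nearly optimal surrogate risk, is `exists_rounds`; it covers the case of Bayes risk
zero as well as the opposite one.

*Generalization.* Threshold events of combinations of `T` members of the class have at most
`((n + 1) ^ d + 1) ^ T * (n + 1) ^ (T + 1)` traces on `n` points, by the Sauer–Shelah lemma for the
class and for the sign patterns of linear spaces of dimension `T + 1`. Symmetrization with a second
sample bounds the exponential moments of the deviation for a measurably selected event
(`integral_exp_selDev_le`), and Borel–Cantelli gives almost sure convergence
(`ae_tendsto_selDev_sparse`).

*Calibration.* The surrogate loss of a long combination is unbounded, but clipping the score at a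
high level does not change the classifier and hardly increases the loss. The loss of the clipped
score is uniformly close to a combination of finitely many threshold events
(`exists_thresholds`), so a nearly optimal empirical risk yields a nearly optimal true risk of
the clipped score. Moving a score by a small amount towards a better classifier where the two
disagree would decrease the surrogate risk in proportion to the excess error
(`exists_calibration`), so the classification risk is nearly optimal too.
-/

namespace Boosting


/-! ### Line search on a convex function of one variable -/

/-- `g` selects subgradients of `f`, and `g` is one-sidedly `B`-Lipschitz: the two properties of a
smooth convex function of one variable and its derivative that the line search analysis uses. -/
structure SmoothConvex (f g : ℝ → ℝ) (B : ℝ) : Prop where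
  tangent : ∀ s t, f s + g s * (t - s) ≤ f t
  lip : ∀ s t, s ≤ t → g t - g s ≤ B * (t - s)

namespace SmoothConvex

variable {f g : ℝ → ℝ} {B : ℝ}

lemma mono (h : SmoothConvex f g B) {s t : ℝ} (hst : s ≤ t) : g s ≤ g t := by
  rcases hst.eq_or_lt with rfl | hlt
  · exact le_rfl
  · have h1 := h.tangent s t
    have h2 := h.tangent t s
    by_contra hc
    push Not at hc
    nlinarith

lemma continuous (h : SmoothConvex f g B) : Continuous g := by
  have h0 : 0 ≤ B := by
    have := h.lip 0 1 zero_le_one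
    have := h.mono (zero_le_one : (0 : ℝ) ≤ 1)
    linarith
  refine (LipschitzWith.of_dist_le_mul (K := ⟨B, h0⟩) fun x y => ?_).continuous
  rw [Real.dist_eq, Real.dist_eq]
  change |g x - g y| ≤ B * |x - y|
  rcases le_total x y with hxy | hxy
  · rw [abs_sub_comm, abs_sub_comm x y, abs_of_nonneg (sub_nonneg.2 hxy),
      abs_of_nonneg (sub_nonneg.2 (h.mono hxy))]
    exact h.lip x y hxy
  · rw [abs_of_nonneg (sub_nonneg.2 hxy), abs_of_nonneg (sub_nonneg.2 (h.mono hxy))]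
    exact h.lip y x hxy

lemma antitone_of_deriv_nonpos (h : SmoothConvex f g B) {s t : ℝ} (hst : s ≤ t) (ht : g t ≤ 0) :
    f t ≤ f s := by
  have := h.tangent t s
  nlinarith

/-- The step `γ / B` of the quadratic upper bound, where `-γ` is the slope at `0`, decreases the
function by at least `γ² / (6B)`, the decrease that a Wolfe step guarantees as well. -/
lemma le_of_quadratic_step (h : SmoothConvex f g B) (hB : 0 < B) {γ : ℝ} (hγ : g 0 = -γ)
    (hγ0 : 0 ≤ γ) : f (γ / B) ≤ f 0 - γ ^ 2 / (6 * B) := by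
  -- Two tangents, at `γ / (2B)` and `γ / B`, give the constant `4` instead of the optimal `2`.
  have hq : 0 ≤ γ / (2 * B) := by positivity
  have e : γ / B = 2 * (γ / (2 * B)) := by field_simp
  have e2 : γ ^ 2 / (6 * B) = γ * (γ / (2 * B)) / 3 := by field_simp; ring
  have eB : B * (γ / (2 * B)) = γ / 2 := by field_simp
  rw [e, e2]
  set q := γ / (2 * B)
  have h1 := h.tangent q 0
  have h2 := h.tangent (2 * q) q
  have l1 := h.lip 0 q hq
  have l2 := h.lip 0 (2 * q) (by linarith)
  have : g q ≤ -γ / 2 := by linarith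
  have : g (2 * q) ≤ 0 := by linarith
  nlinarith

/-- At an exact line search step the derivative is not positive. -/
lemma deriv_nonpos_of_isLineMin (h : SmoothConvex f g B) (hB : 0 < B) (h0 : g 0 ≤ 0) {α : ℝ}
    (hα : IsLineMin f α) : g α ≤ 0 := by
  by_contra hc
  push Not at hc
  have hpos : 0 < α := by
    rcases hα.1.eq_or_lt with h' | h'
    · rw [← h'] at hc; linarith
    · exact h'
  set r := min α (g α / (2 * B)) with hr
  have hr0 : 0 < r := lt_min hpos (by positivity)
  have hrα : r ≤ α := min_le_left _ _
  have hrB : B * r ≤ g α / 2 := by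
    calc B * r ≤ B * (g α / (2 * B)) := by gcongr; exact min_le_right _ _
      _ = g α / 2 := by field_simp
  have h1 := hα.2 (α - r) (by linarith)
  have h2 := h.tangent (α - r) α
  have h3 := h.lip (α - r) α (by linarith)
  have : 0 < g (α - r) := by nlinarith
  nlinarith

/-- A step that stops before an exact line search step, or any step if there is none, has
nonpositive derivative. -/
lemma deriv_nonpos_of_lt_lineMin (h : SmoothConvex f g B) (h0 : g 0 ≤ 0) {α : ℝ} (hα : 0 ≤ α)
    (hs : (∃ β, IsLineMin f β ∧ α < β) ∨ ¬ ∃ β, IsLineMin f β) : g α ≤ 0 := by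
  by_contra hc
  push Not at hc
  rcases hs with ⟨β, hβ, hαβ⟩ | hno
  · have h1 := h.tangent α β
    have h2 := hβ.2 α hα
    nlinarith
  · obtain ⟨s, hs, hs0⟩ := intermediate_value_Icc hα h.continuous.continuousOn ⟨h0, hc.le⟩
    refine hno ⟨s, hs.1, fun β _ => ?_⟩
    have := h.tangent s β
    rw [hs0] at this
    linarith

/-- Growth above the tangent at `0`, from the two tangents at `0` and `s / 2`; this costs a factor
two in the constant and avoids an integral. -/
lemma quadratic_growth (h : SmoothConvex f g B) {k : ℝ}
    (hc : ∀ s ∈ Set.Icc (0 : ℝ) 1, g 0 + k * s ≤ g s) {s : ℝ} (hs : s ∈ Set.Icc (0 : ℝ) 1) :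
    f 0 + g 0 * s + k * s ^ 2 / 4 ≤ f s := by
  have h1 := h.tangent 0 (s / 2)
  have h2 := h.tangent (s / 2) s
  have h3 := hc (s / 2) ⟨by linarith [hs.1], by linarith [hs.2]⟩
  have := hs.1
  nlinarith

end SmoothConvex

/-- What the analysis retains of an admissible step: sufficient decrease, and either the step does
not overshoot the minimum or it satisfies the first Wolfe condition. -/
structure GoodStep (f g : ℝ → ℝ) (B α : ℝ) : Prop where
  nonneg : 0 ≤ α
  decrease : f α ≤ f 0 - (g 0) ^ 2 / (6 * B)
  short : g α ≤ 0 ∨ f α ≤ f 0 + α * (1 / 3) * g 0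

lemma SmoothConvex.goodStep {f g : ℝ → ℝ} {B : ℝ} (h : SmoothConvex f g B) (hB : 0 < B)
    (h0 : g 0 ≤ 0) {α : ℝ} (hα : 0 ≤ α)
    (hs : IsLineMin f α ∨
      (-(g 0) / B ≤ α ∧ ((∃ β, IsLineMin f β ∧ α < β) ∨ ¬ ∃ β, IsLineMin f β)) ∨
      (f α ≤ f 0 + α * (1 / 3) * g 0 ∧ (1 / 2) * g 0 ≤ g α)) :
    GoodStep f g B α := by
  have hq := h.le_of_quadratic_step hB (γ := -(g 0)) (by ring) (by linarith)
  rw [neg_sq] at hq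
  rcases hs with hs | ⟨hs1, hs2⟩ | ⟨hs1, hs2⟩
  · exact ⟨hα, (hs.2 _ (div_nonneg (by linarith) hB.le)).trans hq,
      .inl (h.deriv_nonpos_of_isLineMin hB h0 hs)⟩
  · have := h.deriv_nonpos_of_lt_lineMin h0 hα hs2
    exact ⟨hα, (h.antitone_of_deriv_nonpos hs1 this).trans hq, .inl this⟩
  · refine ⟨hα, hs1.trans ?_, .inr hs1⟩
    have h1 := h.lip 0 α hα
    have h2 : -(g 0) ≤ 2 * B * α := by nlinarith
    have h3 : (g 0) ^ 2 / (6 * B) ≤ α * (1 / 3) * (-(g 0)) := by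
      rw [div_le_iff₀ (by positivity)]
      nlinarith
    linarith

/-- If the function is strongly convex near both end points of the step, the length of the step is
at most a constant times the slope at its starting point. -/
lemma GoodStep.le_mul_slope {f g : ℝ → ℝ} {B α k b : ℝ} (hg : GoodStep f g B α)
    (h : SmoothConvex f g B) (h0 : g 0 ≤ 0) (hk : 0 < k)
    (hf : ∀ s, 0 ≤ f s) (hb : f 0 ≤ b)
    (hstart : ∀ s ∈ Set.Icc (0 : ℝ) 1, g 0 + k * s ≤ g s)
    (hend : ∀ s ∈ Set.Icc (0 : ℝ) 1, g (α - s) ≤ g α - k * s) :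
    α ≤ (3 / k + 22 * b / k ^ 2) * -(g 0) := by
  have hα := hg.nonneg
  have hb0 : 0 ≤ b := (hf 0).trans hb
  set γ := -(g 0) with hγ
  have hγ0 : 0 ≤ γ := by linarith
  have hgγ : g 0 = -γ := by linarith
  have e : (3 / k + 22 * b / k ^ 2) * γ = (3 * k + 22 * b) * γ / k ^ 2 := by field_simp
  rw [e, le_div_iff₀ (by positivity)]
  rcases le_or_gt α 1 with h1 | h1
  · -- A short step: the curvature at the starting point alone bounds it.
    suffices hs : α * k ≤ 3 * γ by nlinarith [mul_nonneg hb0 hγ0]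
    rcases hg.short with hs | hs
    · have := hstart α ⟨hα, h1⟩
      nlinarith
    · have := h.quadratic_growth hstart ⟨hα, h1⟩
      rw [hgγ] at this hs
      rcases hα.eq_or_lt with h' | h'
      · rw [← h']; simpa using hγ0
      · have : α * (k * α / 4 - 2 / 3 * γ) ≤ 0 := by nlinarith
        have := nonpos_of_mul_nonpos_right this h'
        linarith
  · -- A long step: the slope is bounded below, and the step is bounded since `f ≥ 0`.
    rcases hg.short with hs | hs
    · have h2 := hend 1 ⟨zero_le_one, le_rfl⟩
      have h3 := hstart 1 ⟨zero_le_one, le_rfl⟩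
      have h4 := h.mono h1.le
      have hγk : k ≤ γ := by linarith
      have h5 := h.tangent (α - 1) 0
      have h6 := hf (α - 1)
      have h7 : k * (α - 1) ≤ b := by nlinarith
      have h8 : α * k ≤ b + k := by linarith
      calc α * k ^ 2 = (α * k) * k := by ring
        _ ≤ (b + k) * γ := by gcongr
        _ ≤ _ := by nlinarith [mul_nonneg hb0 hγ0, mul_nonneg hk.le hγ0]
    · have h2 := h.quadratic_growth hstart ⟨zero_le_one, le_rfl⟩
      have h3 := h.tangent 1 0
      have h4 := h.tangent 1 α
      have h5 : α * f 1 ≤ α * (f 0 - γ / 3) := by rw [hgγ] at hs; nlinarith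
      have h6 := le_of_mul_le_mul_left h5 (by linarith)
      have h7 : 3 * k ≤ 8 * γ := by rw [hgγ] at h2; linarith
      have h8 : α * γ ≤ 3 * b := by
        have := hf α
        rw [hgγ] at hs
        nlinarith
      have h9 : α * k ^ 2 * 9 ≤ 22 * b * γ * 9 := by
        calc α * k ^ 2 * 9 = α * (3 * k) * (3 * k) := by ring
          _ ≤ α * (8 * γ) * (8 * γ) := by gcongr
          _ = 64 * (α * γ) * γ := by ring
          _ ≤ 64 * (3 * b) * γ := by gcongr
          _ ≤ _ := by nlinarith [mul_nonneg hb0 hγ0]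
      nlinarith [mul_nonneg hk.le hγ0]

/-! ### Properties of the loss -/

section Loss

variable {ℓ : ℝ → ℝ}

lemma IsLbds.tangent (h : IsLbds ℓ) (x y : ℝ) : ℓ x + deriv ℓ x * (y - x) ≤ ℓ y := by
  rcases lt_trichotomy x y with hxy | rfl | hxy
  · have := h.convex.deriv_le_slope (Set.mem_univ x) (Set.mem_univ y) hxy (h.differentiable x)
    rw [slope_def_field, le_div_iff₀ (by linarith)] at this
    linarith
  · simp
  · have := h.convex.slope_le_deriv (Set.mem_univ y) (Set.mem_univ x) hxy (h.differentiable x)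
    rw [slope_def_field, div_le_iff₀ (by linarith)] at this
    linarith

lemma IsLbds.mono_deriv (h : IsLbds ℓ) : Monotone (deriv ℓ) := fun x y hxy =>
  h.convex.monotoneOn_deriv (fun x _ => h.differentiable x) (Set.mem_univ x) (Set.mem_univ y) hxy

lemma IsLbds.monotone (h : IsLbds ℓ) : Monotone ℓ :=
  monotone_of_deriv_nonneg h.differentiable h.deriv_nonneg

lemma IsLbds.continuous (h : IsLbds ℓ) : Continuous ℓ := h.differentiable.continuous

/-- The set of slopes that defines `gradLip` is bounded, so its supremum is not a junk value. -/
lemma IsLbds.gradLip_bound (h : IsLbds ℓ) {x y : ℝ} (hxy : x ≤ y) :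
    deriv ℓ y - deriv ℓ x ≤ gradLip ℓ * (y - x) := by
  rcases hxy.eq_or_lt with rfl | hlt
  · simp
  obtain ⟨K, hK⟩ := h.lipschitz_deriv
  have hbdd : BddAbove (Set.range fun p : ℝ × ℝ => (deriv ℓ p.2 - deriv ℓ p.1) / (p.2 - p.1)) := by
    refine ⟨K, ?_⟩
    rintro _ ⟨p, rfl⟩
    dsimp only
    have h1 := hK.dist_le_mul p.2 p.1
    rw [Real.dist_eq, Real.dist_eq] at h1
    refine (le_abs_self _).trans ?_
    rw [abs_div]
    exact div_le_of_le_mul₀ (abs_nonneg _) K.2 h1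
  have := le_ciSup hbdd (x, y)
  dsimp only at this
  rw [div_le_iff₀ (by linarith)] at this
  exact this

lemma IsLtd.exists_curvature (h : IsLtd ℓ) {u v : ℝ} (huv : u ≤ v) :
    ∃ κ : ℝ, 0 < κ ∧ ∀ x ∈ Set.Icc u v, ∀ y ∈ Set.Icc u v, x ≤ y →
      κ * (y - x) ≤ deriv ℓ y - deriv ℓ x := by
  have hd : ContDiff ℝ 1 (deriv ℓ) := ((contDiff_succ_iff_deriv (n := 1)).1 h.contDiff).2.2
  have hc : Continuous (deriv (deriv ℓ)) := hd.continuous_deriv le_rfl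
  obtain ⟨z, _, hz⟩ := isCompact_Icc.exists_isMinOn (Set.nonempty_Icc.2 huv) hc.continuousOn
  refine ⟨_, h.deriv2_pos z, fun x hx y hy hxy => ?_⟩
  refine (convex_Icc u v).mul_sub_le_image_sub_of_le_deriv hd.continuous.continuousOn
    (hd.differentiable one_ne_zero).differentiableOn (fun w hw => ?_) x hx y hy hxy
  exact hz (interior_subset hw)

lemma gradLip_pos (h : IsLbds ℓ) (h2 : IsLtd ℓ) : 0 < gradLip ℓ := by
  obtain ⟨κ, hκ, hc⟩ := h2.exists_curvature (zero_le_one : (0 : ℝ) ≤ 1)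
  have h1 := hc 0 (by simp) 1 (by simp) zero_le_one
  have h2 := h.gradLip_bound (zero_le_one : (0 : ℝ) ≤ 1)
  linarith

lemma IsLbds.exists_abs_sub_le (h : IsLbds ℓ) : ∃ K : ℝ, 0 < K ∧
    ∀ x y, |ℓ x - ℓ y| ≤ K * |x - y| := by
  obtain ⟨K, hK⟩ := h.lipschitz
  refine ⟨K + 1, by positivity, fun x y => ?_⟩
  have h2 := hK.dist_le_mul x y
  rw [Real.dist_eq, Real.dist_eq] at h2
  nlinarith [abs_nonneg (x - y)]

/-- Strict convexity makes the loss strictly increasing, hence positive. -/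
lemma IsLbds.pos_zero (h : IsLbds ℓ) (h2 : IsLtd ℓ) : 0 < ℓ 0 := by
  obtain ⟨κ, hκ, hc⟩ := h2.exists_curvature (show (-2 : ℝ) ≤ 0 by norm_num)
  have h1 := hc (-2) (by simp) (-1) (by norm_num) (by norm_num)
  have h3 := h.tangent (-1) 0
  have := h.nonneg (-1)
  have := h.deriv_nonneg (-2)
  linarith

end Loss


/-! ### The empirical risk along a line -/

section Linear

variable {X : Type*} {H : Set (X → ℝ)}

lemma predictor_zero (x : X) : predictor H 0 x = 0 := by simp [predictor]

lemma predictor_add (lam v : H →₀ ℝ) (x : X) :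
    predictor H (lam + v) x = predictor H lam x + predictor H v x := by
  unfold predictor
  exact Finsupp.sum_add_index' (by simp) (by intros; ring)

lemma predictor_smul (c : ℝ) (lam : H →₀ ℝ) (x : X) :
    predictor H (c • lam) x = c * predictor H lam x := by
  unfold predictor
  rw [Finsupp.sum_smul_index' (by simp), Finsupp.mul_sum]
  exact Finsupp.sum_congr fun _ _ => by simp; ring

lemma predictor_single (h : H) (c : ℝ) (x : X) :
    predictor H (Finsupp.single h c) x = (h : X → ℝ) x * c := by
  simp [predictor]

lemma negMargin_add (lam v : H →₀ ℝ) (z : X × Bool) :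
    negMargin H (lam + v) z = negMargin H lam z + negMargin H v z := by
  simp only [negMargin, predictor_add]; ring

lemma negMargin_smul (c : ℝ) (v : H →₀ ℝ) (z : X × Bool) :
    negMargin H (c • v) z = c * negMargin H v z := by
  simp only [negMargin, predictor_smul]; ring

lemma negMargin_zero (z : X × Bool) : negMargin H 0 z = 0 := by
  simp [negMargin, predictor_zero]

lemma sgn_sq (y : Bool) : sgn y * sgn y = 1 := by cases y <;> simp [sgn]

lemma negMargin_single_mul_self (hbin : IsBinary H) (h : H) (b : Bool) (z : X × Bool) :
    negMargin H (Finsupp.single h (sgn b)) z * negMargin H (Finsupp.single h (sgn b)) z = 1 := by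
  have hh : (h : X → ℝ) z.1 * (h : X → ℝ) z.1 = 1 := by
    rcases hbin h h.2 z.1 with e | e <;> rw [e] <;> norm_num
  rw [negMargin, predictor_single]
  calc _ = (sgn z.2 * sgn z.2) * (sgn b * sgn b) * ((h : X → ℝ) z.1 * (h : X → ℝ) z.1) := by ring
    _ = 1 := by rw [sgn_sq, sgn_sq, hh]; norm_num

variable {ℓ : ℝ → ℝ} {m : ℕ} (S : Fin m → X × Bool)

lemma empGrad_add (lam v w : H →₀ ℝ) :
    empGrad H ℓ S lam (v + w) = empGrad H ℓ S lam v + empGrad H ℓ S lam w := by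
  simp only [empGrad, negMargin_add, mul_add, Finset.sum_add_distrib]

lemma empGrad_smul (lam : H →₀ ℝ) (c : ℝ) (v : H →₀ ℝ) :
    empGrad H ℓ S lam (c • v) = c * empGrad H ℓ S lam v := by
  simp only [empGrad, negMargin_smul, Finset.mul_sum]
  exact Finset.sum_congr rfl fun _ _ => by ring

lemma empGrad_zero (lam : H →₀ ℝ) : empGrad H ℓ S lam 0 = 0 := by
  simp [empGrad, negMargin_zero]

/-- The tangent inequality for the convex empirical surrogate risk. -/
lemma empLoss_tangent (hℓ : IsLbds ℓ) (lam v : H →₀ ℝ) :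
    empLoss H ℓ S lam + empGrad H ℓ S lam v ≤ empLoss H ℓ S (lam + v) := by
  unfold empLoss empGrad
  rw [← mul_add, ← Finset.sum_add_distrib]
  refine mul_le_mul_of_nonneg_left (Finset.sum_le_sum fun i _ => ?_) (by positivity)
  rw [negMargin_add]
  have := hℓ.tangent (negMargin H lam (S i)) (negMargin H lam (S i) + negMargin H v (S i))
  simpa using this

lemma empLoss_nonneg (hℓ : IsLbds ℓ) (lam : H →₀ ℝ) : 0 ≤ empLoss H ℓ S lam :=
  mul_nonneg (by positivity) (Finset.sum_nonneg fun _ _ => hℓ.nonneg _)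

lemma average_const {m : ℕ} (hm : 1 ≤ m) (c : ℝ) : (1 / (m : ℝ)) * ∑ _i : Fin m, c = c := by
  have : (m : ℝ) ≠ 0 := by positivity
  simp [this]

lemma empLoss_zero (hm : 1 ≤ m) : empLoss H ℓ S 0 = ℓ 0 := by
  simp only [empLoss, negMargin_zero]
  exact average_const hm _

lemma average_le_average {m : ℕ} {u v : Fin m → ℝ} (h : ∀ i, u i ≤ v i) :
    (1 / (m : ℝ)) * ∑ i, u i ≤ (1 / (m : ℝ)) * ∑ i, v i :=
  mul_le_mul_of_nonneg_left (Finset.sum_le_sum fun i _ => h i) (by positivity)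

lemma smoothConvex_empLoss (hℓ : IsLbds ℓ) (hbin : IsBinary H) (hm : 1 ≤ m) (lam : H →₀ ℝ)
    (h : H) (b : Bool) :
    SmoothConvex (fun s => empLoss H ℓ S (lam + s • Finsupp.single h (sgn b)))
      (fun s => empGrad H ℓ S (lam + s • Finsupp.single h (sgn b)) (Finsupp.single h (sgn b)))
      (gradLip ℓ) := by
  set v : H →₀ ℝ := Finsupp.single h (sgn b) with hv
  refine ⟨fun s t => ?_, fun s t hst => ?_⟩
  · have := empLoss_tangent S hℓ (lam + s • v) ((t - s) • v)
    rw [empGrad_smul] at this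
    rw [show lam + t • v = lam + s • v + (t - s) • v by rw [add_assoc, ← add_smul]; congr 2; ring]
    linarith
  · rw [← average_const hm (gradLip ℓ * (t - s))]
    unfold empGrad
    rw [← mul_sub, ← Finset.sum_sub_distrib]
    refine average_le_average fun i => ?_
    have he := negMargin_single_mul_self hbin h b (S i)
    rw [← hv] at he
    simp only [negMargin_add, negMargin_smul]
    set u := negMargin H lam (S i)
    set e := negMargin H v (S i)
    rcases mul_self_eq_one_iff.1 he with e1 | e1 <;> rw [e1]
    · have := hℓ.gradLip_bound (show u + s * 1 ≤ u + t * 1 by linarith)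
      linarith
    · have := hℓ.gradLip_bound (show u + t * -1 ≤ u + s * -1 by linarith)
      linarith

open Classical in
/-- The fraction of the sample whose negative margin is in `[0, M]`. -/
noncomputable def midFraction (H : Set (X → ℝ)) (M : ℝ) {m : ℕ} (S : Fin m → X × Bool)
    (lam : H →₀ ℝ) : ℝ :=
  (1 / (m : ℝ)) * ∑ i, if negMargin H lam (S i) ∈ Set.Icc 0 M then (1 : ℝ) else 0

/-- If `κ` bounds the curvature of the loss on `[-1, M + 1]`, then the empirical risk is strongly
convex along unit coordinate steps, since every example with negative margin in `[0, M]` moves by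
exactly the length of the step. -/
lemma empGrad_curvature (hℓ : IsLbds ℓ) (hbin : IsBinary H) {κ M : ℝ}
    (hκ : ∀ x ∈ Set.Icc (-1) (M + 1), ∀ y ∈ Set.Icc (-1) (M + 1), x ≤ y →
      κ * (y - x) ≤ deriv ℓ y - deriv ℓ x)
    (lam : H →₀ ℝ) (h : H) (b : Bool) {s : ℝ} (hs : s ∈ Set.Icc (0 : ℝ) 1) :
    empGrad H ℓ S lam (Finsupp.single h (sgn b)) + midFraction H M S lam * κ * s ≤
      empGrad H ℓ S (lam + s • Finsupp.single h (sgn b)) (Finsupp.single h (sgn b)) := by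
  set v : H →₀ ℝ := Finsupp.single h (sgn b) with hv
  unfold empGrad midFraction
  rw [mul_assoc, mul_assoc, ← mul_add, Finset.sum_mul, ← Finset.sum_add_distrib]
  refine average_le_average fun i => ?_
  have he := negMargin_single_mul_self hbin h b (S i)
  rw [← hv] at he
  simp only [negMargin_add, negMargin_smul]
  set u := negMargin H lam (S i)
  set e := negMargin H v (S i)
  obtain ⟨hs0, hs1⟩ := hs
  split_ifs with hu
  · obtain ⟨hu0, huM⟩ := hu
    rcases mul_self_eq_one_iff.1 he with e1 | e1 <;> rw [e1]
    · have := hκ u ⟨by linarith, by linarith⟩ (u + s * 1) ⟨by linarith, by linarith⟩ (by linarith)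
      linarith
    · have := hκ (u + s * -1) ⟨by linarith, by linarith⟩ u ⟨by linarith, by linarith⟩ (by linarith)
      linarith
  · rcases mul_self_eq_one_iff.1 he with e1 | e1 <;> rw [e1]
    · have := hℓ.mono_deriv (show u ≤ u + s * 1 by linarith)
      linarith
    · have := hℓ.mono_deriv (show u + s * -1 ≤ u by linarith)
      linarith

/-- The bound of `empGrad_curvature` at the end point of a step. -/
lemma empGrad_curvature_end (hℓ : IsLbds ℓ) (hbin : IsBinary H) {κ M : ℝ}
    (hκ : ∀ x ∈ Set.Icc (-1) (M + 1), ∀ y ∈ Set.Icc (-1) (M + 1), x ≤ y →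
      κ * (y - x) ≤ deriv ℓ y - deriv ℓ x)
    (lam : H →₀ ℝ) (h : H) (b : Bool) (α : ℝ) {s : ℝ} (hs : s ∈ Set.Icc (0 : ℝ) 1) :
    empGrad H ℓ S (lam + (α - s) • Finsupp.single h (sgn b)) (Finsupp.single h (sgn b)) ≤
      empGrad H ℓ S (lam + α • Finsupp.single h (sgn b)) (Finsupp.single h (sgn b)) -
        midFraction H M S (lam + α • Finsupp.single h (sgn b)) * κ * s := by
  have hneg : (Finsupp.single h (sgn (!b)) : H →₀ ℝ) = (-1 : ℝ) • Finsupp.single h (sgn b) := by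
    cases b <;> simp [sgn]
  have := empGrad_curvature S hℓ hbin hκ (lam + α • Finsupp.single h (sgn b)) h (!b) hs
  rw [hneg, empGrad_smul, empGrad_smul] at this
  rw [show lam + (α - s) • Finsupp.single h (sgn b) =
    lam + α • Finsupp.single h (sgn b) + s • (-1 : ℝ) • Finsupp.single h (sgn b) by
      rw [add_assoc, smul_smul, ← add_smul]; congr 2; ring]
  linarith

lemma Errs.negMargin_nonneg {lam : H →₀ ℝ} {z : X × Bool} (h : Errs (predictor H lam) z) :
    0 ≤ negMargin H lam z := by
  rcases h with ⟨h1, h2⟩ | ⟨h1, h2⟩ <;> rw [negMargin, h1] <;> simp [sgn] <;> linarith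

/-- Few examples have a large negative margin when the empirical risk is at most its initial
value, so that the misclassified ones mostly have negative margin in `[0, M]`. -/
lemma empErr_le_midFraction (hℓ : IsLbds ℓ) {β M : ℝ} (hβ : 0 < β)
    (hβℓ : ∀ z, 0 ≤ z → β ≤ deriv ℓ z) (hM : 0 < M) (lam : H →₀ ℝ) :
    empErr S (predictor H lam) ≤ midFraction H M S lam + empLoss H ℓ S lam / (β * M) := by
  unfold empErr midFraction empLoss
  rw [mul_div_assoc, Finset.sum_div, ← mul_add, ← Finset.sum_add_distrib]
  refine average_le_average fun i => ?_
  have hnn : 0 ≤ ℓ (negMargin H lam (S i)) / (β * M) := div_nonneg (hℓ.nonneg _) (by positivity)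
  have hbig : M ≤ negMargin H lam (S i) → 1 ≤ ℓ (negMargin H lam (S i)) / (β * M) := by
    intro hu
    rw [le_div_iff₀ (by positivity)]
    have h1 := hℓ.tangent 0 (negMargin H lam (S i))
    have h2 := hβℓ 0 le_rfl
    have h3 := hℓ.nonneg 0
    nlinarith
  split_ifs with h1 h2 h2
  · linarith
  · have := h1.negMargin_nonneg
    have : M ≤ negMargin H lam (S i) := by
      by_contra hc
      exact h2 ⟨this, (not_le.1 hc).le⟩
    linarith [hbig this]
  · linarith
  · linarith

lemma midFraction_zero (hm : 1 ≤ m) {M : ℝ} (hM : 0 ≤ M) : midFraction H M S 0 = 1 := by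
  simp only [midFraction, negMargin_zero, Set.left_mem_Icc, hM, if_true]
  exact average_const hm 1

/-- The norm of the gradient controls the derivative in the direction of a fixed weighting. -/
lemma exists_abs_empGrad_le (H : Set (X → ℝ)) (ℓ : ℝ → ℝ) (v : H →₀ ℝ) : ∃ b : ℝ, 0 ≤ b ∧
    ∀ (m : ℕ) (S : Fin m → X × Bool) (lam : H →₀ ℝ) (G : ℝ),
      (∀ h, |empGrad H ℓ S lam (Finsupp.single h 1)| ≤ G) → |empGrad H ℓ S lam v| ≤ b * G := by
  induction v using Finsupp.induction_linear with
  | zero => exact ⟨0, le_rfl, fun m S lam G _ => by simp [empGrad_zero]⟩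
  | add v w hv hw =>
    obtain ⟨b, hb, hv⟩ := hv
    obtain ⟨c, hc, hw⟩ := hw
    refine ⟨b + c, by positivity, fun m S lam G hG => ?_⟩
    rw [empGrad_add, add_mul]
    exact (abs_add_le _ _).trans (add_le_add (hv m S lam G hG) (hw m S lam G hG))
  | single h c =>
    refine ⟨|c|, abs_nonneg _, fun m S lam G hG => ?_⟩
    rw [show (Finsupp.single h c : H →₀ ℝ) = c • Finsupp.single h 1 by simp, empGrad_smul, abs_mul]
    exact mul_le_mul_of_nonneg_left (hG h) (abs_nonneg _)

/-- The coordinates of the gradient are bounded, so that their supremum is not a junk value. -/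
lemma bddAbove_abs_empGrad (hℓ : IsLbds ℓ) (hbin : IsBinary H) (lam : H →₀ ℝ) :
    BddAbove (Set.range fun h : H => |empGrad H ℓ S lam (Finsupp.single h 1)|) := by
  refine ⟨(1 / (m : ℝ)) * ∑ i, deriv ℓ (negMargin H lam (S i)), ?_⟩
  rintro _ ⟨h, rfl⟩
  dsimp only
  unfold empGrad
  rw [abs_mul, abs_of_nonneg (show (0 : ℝ) ≤ 1 / m by positivity)]
  refine mul_le_mul_of_nonneg_left ((Finset.abs_sum_le_sum_abs _ _).trans
    (Finset.sum_le_sum fun i _ => ?_)) (by positivity)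
  have he := negMargin_single_mul_self hbin h true (S i)
  simp only [sgn, if_true] at he
  rw [abs_mul, abs_of_nonneg (hℓ.deriv_nonneg _)]
  rcases mul_self_eq_one_iff.1 he with e1 | e1 <;> rw [e1] <;> simp

end Linear

/-! ### Convergence of coordinate descent -/

/-- The slopes `γ` of the rounds cannot be square summable with a fixed bound and at the same time
be at least of the order of the inverse of the norm of the iterate: the norm is `O(√t)`, and the
harmonic series diverges. -/
lemma exists_round_small_slope {b c Γ ε : ℝ} (hb : 0 ≤ b) (hc : 0 ≤ c) (hΓ : 0 ≤ Γ)
    (hε : 0 < ε) : ∃ T₀ : ℕ, ∀ T ≥ T₀, ∀ γ : ℕ → ℝ, (∀ t < T, 0 ≤ γ t) →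
      ∑ t ∈ Finset.range T, γ t ^ 2 ≤ Γ →
      ∃ t < T, γ t * (b + c * ∑ s ∈ Finset.range t, γ s) < ε := by
  set D := b + c * √Γ + 1 with hD
  have hD0 : 0 < D := by positivity
  obtain ⟨T₀, hT₀⟩ := (tendsto_atTop.1 Real.tendsto_sum_range_one_div_nat_succ_atTop
    ((Γ + 1) * D ^ 2 / ε ^ 2)).exists_forall_of_atTop
  refine ⟨T₀, fun T hT γ hγ hsum => ?_⟩
  by_contra! hcon
  have key : ∀ t ∈ Finset.range T, ε ^ 2 / D ^ 2 * (1 / ((t : ℝ) + 1)) ≤ γ t ^ 2 := by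
    intro t ht
    have htT := Finset.mem_range.1 ht
    have h1 := hcon t htT
    have hγt := hγ t htT
    have hs1 : (∑ s ∈ Finset.range t, γ s) ^ 2 ≤ (t + 1) * Γ := by
      refine sq_sum_le_card_mul_sum_sq.trans ?_
      rw [Finset.card_range]
      have : ∑ s ∈ Finset.range t, γ s ^ 2 ≤ Γ := (Finset.sum_le_sum_of_subset_of_nonneg
        (Finset.range_mono htT.le) (fun _ _ _ => sq_nonneg _)).trans hsum
      have hn : 0 ≤ ∑ s ∈ Finset.range t, γ s ^ 2 := Finset.sum_nonneg fun _ _ => sq_nonneg _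
      nlinarith
    have hs2 : ∑ s ∈ Finset.range t, γ s ≤ √((t : ℝ) + 1) * √Γ := by
      rw [← Real.sqrt_mul (by positivity)]
      exact Real.le_sqrt_of_sq_le hs1
    have h1t : 1 ≤ √((t : ℝ) + 1) := Real.one_le_sqrt.2 (by
      linarith [(Nat.cast_nonneg t : (0 : ℝ) ≤ t)])
    have h2 : b + c * ∑ s ∈ Finset.range t, γ s ≤ D * √((t : ℝ) + 1) := by
      have := mul_le_mul_of_nonneg_left hs2 hc
      rw [hD]
      nlinarith
    have h3 : ε ≤ γ t * (D * √((t : ℝ) + 1)) := h1.trans (mul_le_mul_of_nonneg_left h2 hγt)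
    have h4 : ε ^ 2 ≤ γ t ^ 2 * (D ^ 2 * ((t : ℝ) + 1)) := by
      have := pow_le_pow_left₀ hε.le h3 2
      rwa [mul_pow, mul_pow, Real.sq_sqrt (by positivity)] at this
    rw [div_mul_div_comm, mul_one, div_le_iff₀ (by positivity)]
    exact h4
  have h5 := (Finset.sum_le_sum key).trans hsum
  rw [← Finset.mul_sum] at h5
  have h6 := mul_le_mul_of_nonneg_left (hT₀ T hT) (show 0 ≤ ε ^ 2 / D ^ 2 by positivity)
  have h7 : ε ^ 2 / D ^ 2 * ((Γ + 1) * D ^ 2 / ε ^ 2) = Γ + 1 := by field_simp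
  linarith

section Run

variable {X : Type*} {H : Set (X → ℝ)} {ℓ : ℝ → ℝ} {ρ : ℝ} {T m : ℕ}
  {C : Choices X H} {S : Fin m → X × Bool}

lemma Choices.IsRun.goodStep (hℓ : IsLbds ℓ) (h2 : IsLtd ℓ) (hbin : IsBinary H) (hm : 1 ≤ m)
    (hrun : C.IsRun ℓ ρ T m S) {t : ℕ} (ht : t < T) :
    GoodStep (fun s => empLoss H ℓ S (C.iterate m S t + s • C.dir m S t))
      (fun s => empGrad H ℓ S (C.iterate m S t + s • C.dir m S t) (C.dir m S t))
      (gradLip ℓ) (C.step m S t) := by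
  have hsc := smoothConvex_empLoss S hℓ hbin hm (C.iterate m S t) (C.weak m S t) (C.sign m S t)
  obtain ⟨h0, hs⟩ := hrun.step_admissible t ht
  refine SmoothConvex.goodStep hsc (gradLip_pos hℓ h2) ?_ h0 ?_
  · simpa [Choices.dir] using hrun.descent t ht
  · simpa [Choices.dir] using hs

/-- The number `-D L̂(λ_t)[v_t] ≥ 0`. -/
noncomputable def Choices.slope (C : Choices X H) (ℓ : ℝ → ℝ) (m : ℕ) (S : Fin m → X × Bool)
    (t : ℕ) : ℝ :=
  -empGrad H ℓ S (C.iterate m S t) (C.dir m S t)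

lemma Choices.IsRun.decrease (hℓ : IsLbds ℓ) (h2 : IsLtd ℓ) (hbin : IsBinary H) (hm : 1 ≤ m)
    (hrun : C.IsRun ℓ ρ T m S) {t : ℕ} (ht : t < T) :
    C.slope ℓ m S t ^ 2 ≤ 6 * gradLip ℓ *
      (empLoss H ℓ S (C.iterate m S t) - empLoss H ℓ S (C.iterate m S (t + 1))) := by
  have h := (hrun.goodStep hℓ h2 hbin hm ht).decrease
  have hB := gradLip_pos hℓ h2
  simp only [zero_smul, add_zero] at h
  rw [Choices.slope, neg_sq, ← div_le_iff₀' (by positivity), Choices.iterate]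
  linarith

lemma Choices.IsRun.sum_sq_slope_le (hℓ : IsLbds ℓ) (h2 : IsLtd ℓ) (hbin : IsBinary H)
    (hm : 1 ≤ m) (hrun : C.IsRun ℓ ρ T m S) :
    ∑ t ∈ Finset.range T, C.slope ℓ m S t ^ 2 ≤ 6 * gradLip ℓ * ℓ 0 := by
  refine (Finset.sum_le_sum fun t ht =>
    hrun.decrease hℓ h2 hbin hm (Finset.mem_range.1 ht)).trans ?_
  rw [← Finset.mul_sum, Finset.sum_range_sub']
  refine mul_le_mul_of_nonneg_left ?_ (by linarith [gradLip_pos hℓ h2])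
  have := empLoss_nonneg S hℓ (C.iterate m S T)
  rw [show C.iterate m S 0 = 0 from rfl, empLoss_zero S hm]
  linarith

lemma Choices.IsRun.empLoss_antitone (hℓ : IsLbds ℓ) (h2 : IsLtd ℓ) (hbin : IsBinary H)
    (hm : 1 ≤ m) (hrun : C.IsRun ℓ ρ T m S) {s t : ℕ} (hst : s ≤ t) (ht : t ≤ T) :
    empLoss H ℓ S (C.iterate m S t) ≤ empLoss H ℓ S (C.iterate m S s) := by
  induction t, hst using Nat.le_induction with
  | base => exact le_rfl
  | succ t _ ih =>
    refine le_trans ?_ (ih (by omega))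
    have h := hrun.decrease hℓ h2 hbin hm (show t < T by omega)
    have hB := gradLip_pos hℓ h2
    have : 0 ≤ 6 * gradLip ℓ *
      (empLoss H ℓ S (C.iterate m S t) - empLoss H ℓ S (C.iterate m S (t + 1))) :=
      (sq_nonneg _).trans h
    have := nonneg_of_mul_nonneg_right this (by positivity)
    linarith

lemma Choices.abs_empGrad_dir (lam : H →₀ ℝ) (t : ℕ) :
    |empGrad H ℓ S lam (C.dir m S t)| =
      |empGrad H ℓ S lam (Finsupp.single (C.weak m S t) 1)| := by
  rw [Choices.dir, show (Finsupp.single (C.weak m S t) (sgn (C.sign m S t)) : H →₀ ℝ) =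
    sgn (C.sign m S t) • Finsupp.single (C.weak m S t) 1 by simp, empGrad_smul, abs_mul]
  cases C.sign m S t <;> simp [sgn]

/-- The slope of a round dominates all coordinates of the gradient, up to the factor `ρ`. -/
lemma Choices.IsRun.abs_empGrad_single_le (hℓ : IsLbds ℓ) (hbin : IsBinary H) (hρ : 0 < ρ)
    (hrun : C.IsRun ℓ ρ T m S) {t : ℕ} (ht : t < T) (h : H) :
    |empGrad H ℓ S (C.iterate m S t) (Finsupp.single h 1)| ≤ C.slope ℓ m S t / ρ := by
  have h1 := hrun.weak_approx t ht
  have h2 := hrun.descent t ht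
  rw [ApproxBest, ← C.abs_empGrad_dir, abs_of_nonpos h2] at h1
  rw [le_div_iff₀ hρ, mul_comm]
  refine le_trans (mul_le_mul_of_nonneg_left ?_ hρ.le) h1
  exact le_ciSup (bddAbove_abs_empGrad S hℓ hbin _) h

lemma Choices.abs_empGrad_iterate_le {G : ℝ} (lam : H →₀ ℝ)
    (hG : ∀ h, |empGrad H ℓ S lam (Finsupp.single h 1)| ≤ G) {t : ℕ}
    (hs : ∀ s < t, 0 ≤ C.step m S s) :
    |empGrad H ℓ S lam (C.iterate m S t)| ≤ (∑ s ∈ Finset.range t, C.step m S s) * G := by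
  induction t with
  | zero => simp [Choices.iterate, empGrad_zero]
  | succ t ih =>
    rw [Choices.iterate, empGrad_add, empGrad_smul, Finset.sum_range_succ, add_mul]
    refine (abs_add_le _ _).trans (add_le_add (ih fun s hs' => hs s (by omega)) ?_)
    rw [abs_mul, C.abs_empGrad_dir, abs_of_nonneg (hs t (by omega))]
    exact mul_le_mul_of_nonneg_left (hG _) (hs t (by omega))

/-- Boosting either reaches a small empirical classification error, or, as long as it does not,
the curvature of the empirical risk keeps the steps commensurate with the slopes, and the empirical
surrogate risk gets close to that of any fixed competitor. The number of rounds needed does not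
depend on the sample. -/
theorem exists_rounds (hℓ : IsLbds ℓ) (h2 : IsLtd ℓ) (hbin : IsBinary H) (hρ : 0 < ρ)
    {ε δ : ℝ} (hε : 0 < ε) (hδ : 0 < δ) (lamBar : H →₀ ℝ) :
    ∃ T₀ : ℕ, ∀ T ≥ T₀, ∀ (C : Choices X H) (m : ℕ) (S : Fin m → X × Bool), 1 ≤ m →
      C.IsRun ℓ ρ T m S →
      (∃ t, 1 ≤ t ∧ t ≤ T ∧ empErr S (predictor H (C.iterate m S t)) ≤ ε) ∨
        empLoss H ℓ S (C.iterate m S T) ≤ empLoss H ℓ S lamBar + δ := by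
  obtain ⟨β, hβ, hβℓ⟩ := hℓ.deriv_lower
  have hℓ0 := hℓ.pos_zero h2
  have hB := gradLip_pos hℓ h2
  -- With this `M`, at most a fraction `ε / 2` of the sample has negative margin above `M`.
  set M := 2 * ℓ 0 / (β * ε) with hM
  have hM0 : 0 < M := by positivity
  obtain ⟨κ, hκ, hcurv⟩ := h2.exists_curvature (show (-1 : ℝ) ≤ M + 1 by linarith)
  set θ := min 1 (ε / 2) with hθ
  have hθ0 : 0 < θ := lt_min one_pos (by positivity)
  set k := θ * κ with hk
  have hk0 : 0 < k := by positivity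
  set A := 3 / k + 22 * ℓ 0 / k ^ 2 with hA
  have hA0 : 0 < A := by positivity
  obtain ⟨b, hb, hbv⟩ := exists_abs_empGrad_le H ℓ lamBar
  obtain ⟨T₀, hT₀⟩ := exists_round_small_slope hb hA0.le
    (show 0 ≤ 6 * gradLip ℓ * ℓ 0 by positivity) (show 0 < ρ * δ by positivity)
  refine ⟨T₀, fun T hT C m S hm hrun => ?_⟩
  by_cases herr : ∃ t, 1 ≤ t ∧ t ≤ T ∧ empErr S (predictor H (C.iterate m S t)) ≤ ε
  · exact .inl herr
  right
  push Not at herr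
  have hloss : ∀ t ≤ T, empLoss H ℓ S (C.iterate m S t) ≤ ℓ 0 := fun t ht => by
    have := hrun.empLoss_antitone hℓ h2 hbin hm (Nat.zero_le t) ht
    rwa [show C.iterate m S 0 = 0 from rfl, empLoss_zero S hm] at this
  have hmid : ∀ t ≤ T, θ ≤ midFraction H M S (C.iterate m S t) := by
    intro t ht
    rcases Nat.eq_zero_or_pos t with rfl | htp
    · rw [show C.iterate m S 0 = 0 from rfl, midFraction_zero S hm hM0.le]
      exact min_le_left _ _
    · have h3 := empErr_le_midFraction S hℓ hβ hβℓ hM0 (C.iterate m S t)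
      have h4 := herr t htp ht
      have h5 : empLoss H ℓ S (C.iterate m S t) / (β * M) ≤ ε / 2 := by
        rw [div_le_iff₀ (by positivity)]
        refine (hloss t ht).trans (le_of_eq ?_)
        rw [hM]; field_simp
      exact (min_le_right _ _).trans (by linarith)
  have hstep : ∀ t < T, C.step m S t ≤ A * C.slope ℓ m S t := by
    intro t ht
    have hg := hrun.goodStep hℓ h2 hbin hm ht
    have hsc := smoothConvex_empLoss S hℓ hbin hm (C.iterate m S t) (C.weak m S t) (C.sign m S t)
    have := hg.le_mul_slope (k := k) (b := ℓ 0) hsc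
      (by simpa [Choices.dir] using hrun.descent t ht) hk0
      (fun s => empLoss_nonneg S hℓ _) (by simpa using hloss t ht.le) ?_ ?_
    · simpa [Choices.slope] using this
    · intro s hs
      have h3 := empGrad_curvature S hℓ hbin hcurv (C.iterate m S t) (C.weak m S t)
        (C.sign m S t) hs
      have h4 : k * s ≤ midFraction H M S (C.iterate m S t) * κ * s :=
        mul_le_mul_of_nonneg_right (mul_le_mul_of_nonneg_right (hmid t ht.le) hκ.le) hs.1
      simp only [zero_smul, add_zero, Choices.dir]
      linarith
    · intro s hs
      have h3 := empGrad_curvature_end S hℓ hbin hcurv (C.iterate m S t) (C.weak m S t)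
        (C.sign m S t) (C.step m S t) hs
      have h4 : k * s ≤ midFraction H M S (C.iterate m S (t + 1)) * κ * s :=
        mul_le_mul_of_nonneg_right (mul_le_mul_of_nonneg_right (hmid (t + 1) ht) hκ.le) hs.1
      simp only [Choices.iterate] at h4
      simp only [Choices.dir] at h4 ⊢
      linarith
  have hslope0 : ∀ t < T, 0 ≤ C.slope ℓ m S t := fun t ht => by
    have := hrun.descent t ht
    rw [Choices.slope]; linarith
  obtain ⟨t, ht, hsmall⟩ := hT₀ T hT (C.slope ℓ m S) hslope0 (hrun.sum_sq_slope_le hℓ h2 hbin hm)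
  refine (hrun.empLoss_antitone hℓ h2 hbin hm ht.le le_rfl).trans ?_
  have hG := hrun.abs_empGrad_single_le hℓ hbin hρ ht
  have h3 := hbv m S _ _ hG
  have h4 := C.abs_empGrad_iterate_le (C.iterate m S t) hG (t := t)
    fun s hs => (hrun.goodStep hℓ h2 hbin hm (hs.trans ht)).nonneg
  have h5 : ∑ s ∈ Finset.range t, C.step m S s ≤ A * ∑ s ∈ Finset.range t, C.slope ℓ m S s := by
    rw [Finset.mul_sum]
    exact Finset.sum_le_sum fun s hs => hstep s ((Finset.mem_range.1 hs).trans ht)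
  have h6 := empLoss_tangent S hℓ (C.iterate m S t) (lamBar + (-1 : ℝ) • C.iterate m S t)
  rw [empGrad_add, empGrad_smul, show C.iterate m S t + (lamBar + (-1 : ℝ) • C.iterate m S t) =
    lamBar by simp] at h6
  have hd0 : 0 ≤ C.slope ℓ m S t / ρ := div_nonneg (hslope0 t ht) hρ.le
  have h7 : b * (C.slope ℓ m S t / ρ) +
      (∑ s ∈ Finset.range t, C.step m S s) * (C.slope ℓ m S t / ρ) ≤ δ := by
    rw [← add_mul]
    calc _ ≤ (b + A * ∑ s ∈ Finset.range t, C.slope ℓ m S s) * (C.slope ℓ m S t / ρ) := by gcongr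
      _ = (C.slope ℓ m S t * (b + A * ∑ s ∈ Finset.range t, C.slope ℓ m S s)) / ρ := by ring
      _ ≤ δ := by rw [div_le_iff₀ hρ]; linarith
  have h8 := abs_le.1 h3
  have h9 := abs_le.1 h4
  linarith [h8.1, h9.2]

end Run


/-! ### Counting traces on a finite sample -/

lemma card_filter_card_le {α : Type*} (P : Finset α) (k : ℕ) :
    (P.powerset.filter (fun s => s.card ≤ k)).card ≤ (P.card + 1) ^ k := by
  classical
  have h1 : P.powerset.filter (fun s => s.card ≤ k) ⊆
      (Finset.range (k + 1)).biUnion fun j => P.powersetCard j := by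
    intro s hs
    rw [Finset.mem_filter, Finset.mem_powerset] at hs
    simp only [Finset.mem_biUnion, Finset.mem_range, Finset.mem_powersetCard]
    exact ⟨s.card, by omega, hs.1, rfl⟩
  calc _ ≤ _ := Finset.card_le_card h1
    _ ≤ ∑ j ∈ Finset.range (k + 1), (P.powersetCard j).card := Finset.card_biUnion_le
    _ ≤ ∑ j ∈ Finset.range (k + 1), P.card ^ j * 1 ^ (k - j) * k.choose j := by
        refine Finset.sum_le_sum fun j hj => ?_
        rw [Finset.card_powersetCard, one_pow, mul_one]
        exact (Nat.choose_le_pow _ _).trans (Nat.le_mul_of_pos_right _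
          (Nat.choose_pos (Nat.lt_succ_iff.1 (Finset.mem_range.1 hj))))
    _ = _ := by rw [add_pow]; simp

section Trace

variable {ι : Type*} [Fintype ι] [DecidableEq ι]

/-- The Sauer–Shelah lemma in polynomial form. -/
lemma card_le_of_shatters_card_le (𝒜 : Finset (Finset ι)) {d : ℕ}
    (h : ∀ s, 𝒜.Shatters s → s.card ≤ d) : 𝒜.card ≤ (Fintype.card ι + 1) ^ d := by
  refine (Finset.card_le_card_shatterer 𝒜).trans (le_trans (Finset.card_le_card ?_)
    (card_filter_card_le (Finset.univ : Finset ι) d))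
  intro s hs
  simpa using h s (Finset.mem_shatterer.1 hs)

variable {X : Type*} {H : Set (X → ℝ)}

open Classical in
lemma card_binary_traces {d : ℕ} (hvc : ∀ s : Finset X, Shatters H s → s.card ≤ d) (p : ι → X) :
    (Finset.univ.filter fun A : Finset ι => ∃ h ∈ H, ∀ i, i ∈ A ↔ h (p i) = 1).card ≤
      (Fintype.card ι + 1) ^ d := by
  refine card_le_of_shatters_card_le _ fun s hs => ?_
  have hinj : Set.InjOn p s := by
    intro i hi j hj hij
    by_contra hne
    obtain ⟨u, hu, hut⟩ := hs (Finset.singleton_subset_iff.2 hi)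
    obtain ⟨h, _, hA⟩ := (Finset.mem_filter.1 hu).2
    have h1 : i ∈ u := (Finset.mem_inter.1 (hut ▸ Finset.mem_singleton_self i)).2
    have h2 : j ∈ u := (hA j).2 (hij ▸ (hA i).1 h1)
    have : j ∈ s ∩ u := Finset.mem_inter.2 ⟨hj, h2⟩
    rw [hut, Finset.mem_singleton] at this
    exact hne this.symm
  rw [← Finset.card_image_of_injOn hinj]
  refine hvc _ fun t ht => ?_
  obtain ⟨u, hu, hut⟩ := hs (Finset.filter_subset (fun i => p i ∈ t) s)
  obtain ⟨h, hH, hA⟩ := (Finset.mem_filter.1 hu).2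
  refine ⟨h, hH, fun x hx => ?_⟩
  obtain ⟨i, hi, rfl⟩ := Finset.mem_image.1 hx
  have : i ∈ s ∩ u ↔ i ∈ s.filter (fun i => p i ∈ t) := by rw [hut]
  simpa [hi, hA i] using this

open Classical in
/-- The sign patterns of a linear space have VC dimension at most its dimension: otherwise some
nonzero functional `w` would vanish on the restrictions to the shattered set, although it is
positive on a vector with the signs of `w`. -/
lemma shatters_card_le_finrank (V : Submodule ℝ (ι → ℝ)) {s : Finset ι}
    (hs : (Finset.univ.filter fun A : Finset ι => ∃ g ∈ V, ∀ i, i ∈ A ↔ 0 ≤ g i).Shatters s) :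
    s.card ≤ Module.finrank ℝ V := by
  by_contra! hlt
  let R : (ι → ℝ) →ₗ[ℝ] (s → ℝ) := LinearMap.funLeft ℝ ℝ ((↑) : s → ι)
  have hVR : V.map R < ⊤ := by
    refine lt_top_iff_ne_top.2 fun htop => ?_
    have h1 := Submodule.finrank_map_le R V
    rw [htop, finrank_top, Module.finrank_fintype_fun_eq_card, Fintype.card_coe] at h1
    omega
  obtain ⟨w, hw0, hwV⟩ := Submodule.exists_le_ker_of_lt_top _ hVR
  have hsum : ∀ v : s → ℝ, w v = ∑ i, v i * w (Pi.single i 1) := fun v => by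
    rw [LinearMap.pi_apply_eq_sum_univ w v]
    refine Finset.sum_congr rfl fun i _ => ?_
    rw [smul_eq_mul]
    congr 2
    ext j
    rw [Pi.single_apply]
    exact if_congr eq_comm rfl rfl
  have hex : ∃ i, w (Pi.single i 1) ≠ 0 := by
    by_contra! hall
    exact hw0 (LinearMap.ext fun v => by rw [hsum]; simp [hall])
  obtain ⟨i₀, hi₀⟩ := hex
  have main : ∀ w : (s → ℝ) →ₗ[ℝ] ℝ, (∀ v, w v = ∑ i, v i * w (Pi.single i 1)) →
      V.map R ≤ LinearMap.ker w → ¬ w (Pi.single i₀ 1) < 0 := by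
    intro w hsum hwV hneg
    obtain ⟨u, hu, hut⟩ :=
      hs (Finset.filter_subset (fun i => ∀ hi : i ∈ s, 0 ≤ w (Pi.single ⟨i, hi⟩ 1)) s)
    obtain ⟨g, hg, hA⟩ := (Finset.mem_filter.1 hu).2
    have hiff : ∀ i : s, 0 ≤ g i ↔ 0 ≤ w (Pi.single i 1) := by
      rintro ⟨i, hi⟩
      have : i ∈ s ∩ u ↔ i ∈ s.filter (fun i => ∀ hi : i ∈ s, 0 ≤ w (Pi.single ⟨i, hi⟩ 1)) := by
        rw [hut]
      simpa [hi, hA i] using this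
    have hzero : w (R g) = 0 := hwV (Submodule.mem_map_of_mem hg)
    rw [hsum] at hzero
    have hpos : 0 < ∑ i : s, (R g) i * w (Pi.single i 1) := by
      refine Finset.sum_pos' (fun i _ => ?_) ⟨i₀, Finset.mem_univ _, ?_⟩
      · change 0 ≤ g i * _
        rcases le_or_gt 0 (w (Pi.single i 1)) with h | h
        · exact mul_nonneg ((hiff i).2 h) h
        · have : g i < 0 := not_le.1 fun hc => absurd ((hiff i).1 hc) (not_le.2 h)
          exact (mul_pos_of_neg_of_neg this h).le
      · change 0 < g i₀ * _
        have : g i₀ < 0 := not_le.1 fun hc => absurd ((hiff i₀).1 hc) (not_le.2 hneg)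
        exact mul_pos_of_neg_of_neg this hneg
    linarith
  rcases lt_or_gt_of_ne hi₀ with h | h
  · exact main w hsum hwV h
  · refine main (-w) (fun v => by rw [LinearMap.neg_apply, hsum v]; simp) (fun v hv => ?_)
      (by simpa using h)
    have : w v = 0 := hwV hv
    simp [this]

open Classical in
lemma card_sign_patterns (V : Submodule ℝ (ι → ℝ)) {k : ℕ} (hk : Module.finrank ℝ V ≤ k) :
    (Finset.univ.filter fun A : Finset ι => ∃ g ∈ V, ∀ i, i ∈ A ↔ 0 ≤ g i).card ≤
      (Fintype.card ι + 1) ^ k :=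
  card_le_of_shatters_card_le _ fun _ hs => (shatters_card_le_finrank V hs).trans hk

open Classical in
/-- The sign patterns of the sparse combinations of a VC class, with a fixed offset `u`. -/
lemma card_sparse_patterns (hbin : IsBinary H) {d : ℕ}
    (hvc : ∀ s : Finset X, Shatters H s → s.card ≤ d) (T : ℕ) (p : ι → X) (u : ι → ℝ) :
    (Finset.univ.filter fun A : Finset ι => ∃ lam : H →₀ ℝ, lam.support.card ≤ T ∧
        ∀ i, i ∈ A ↔ 0 ≤ predictor H lam (p i) + u i).card ≤
      ((Fintype.card ι + 1) ^ d + 1) ^ T * (Fintype.card ι + 1) ^ (T + 1) := by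
  set 𝒬 : Finset (ι → ℝ) :=
    (Finset.univ.filter fun A : Finset ι => ∃ h ∈ H, ∀ i, i ∈ A ↔ h (p i) = 1).image
      fun A i => if i ∈ A then 1 else -1 with h𝒬
  have h𝒬card : 𝒬.card ≤ (Fintype.card ι + 1) ^ d :=
    Finset.card_image_le.trans (card_binary_traces hvc p)
  have hmem : ∀ h : H, (fun i => (h : X → ℝ) (p i)) ∈ 𝒬 := by
    intro h
    refine Finset.mem_image.2 ⟨Finset.univ.filter fun i => (h : X → ℝ) (p i) = 1, ?_, ?_⟩
    · exact Finset.mem_filter.2 ⟨Finset.mem_univ _, h, h.2, by simp⟩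
    · ext i
      rcases hbin h h.2 (p i) with e | e
      · simp [e]
      · simp only [Finset.mem_filter, Finset.mem_univ, true_and, e]; norm_num
  have hsub : (Finset.univ.filter fun A : Finset ι => ∃ lam : H →₀ ℝ, lam.support.card ≤ T ∧
        ∀ i, i ∈ A ↔ 0 ≤ predictor H lam (p i) + u i) ⊆
      (𝒬.powerset.filter fun Q => Q.card ≤ T).biUnion fun Q =>
        Finset.univ.filter fun A : Finset ι =>
          ∃ g ∈ Submodule.span ℝ ((insert u Q : Finset (ι → ℝ)) : Set (ι → ℝ)),
            ∀ i, i ∈ A ↔ 0 ≤ g i := by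
    intro A hA
    obtain ⟨lam, hlam, hA⟩ := (Finset.mem_filter.1 hA).2
    refine Finset.mem_biUnion.2 ⟨lam.support.image fun (h : H) i => (h : X → ℝ) (p i), ?_, ?_⟩
    · rw [Finset.mem_filter, Finset.mem_powerset]
      refine ⟨fun v hv => ?_, Finset.card_image_le.trans hlam⟩
      obtain ⟨h, _, rfl⟩ := Finset.mem_image.1 hv
      exact hmem h
    · refine Finset.mem_filter.2 ⟨Finset.mem_univ _,
        fun i => predictor H lam (p i) + u i, ?_, hA⟩
      have e : (fun i => predictor H lam (p i) + u i) =
          (∑ h ∈ lam.support, lam h • fun i => (h : X → ℝ) (p i)) + u := by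
        ext i
        simp [predictor, Finsupp.sum, mul_comm]
      rw [e]
      refine Submodule.add_mem _ (Submodule.sum_mem _ fun h hh => Submodule.smul_mem _ _
        (Submodule.subset_span ?_)) (Submodule.subset_span (by simp))
      rw [Finset.coe_insert]
      exact Set.mem_insert_of_mem _ (Finset.mem_coe.2 (Finset.mem_image_of_mem _ hh))
  refine (Finset.card_le_card hsub).trans ((Finset.card_biUnion_le_card_mul _ _
    ((Fintype.card ι + 1) ^ (T + 1)) fun Q hQ => ?_).trans (Nat.mul_le_mul_right _ ?_))
  · refine card_sign_patterns _ ((finrank_span_finset_le_card _).trans ?_)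
    have := (Finset.mem_filter.1 hQ).2
    have := Finset.card_insert_le u Q
    omega
  · exact (card_filter_card_le 𝒬 T).trans (by gcongr)

end Trace

/-- `N` bounds the number of traces of the sets of the family `𝓕` on samples indexed by `ι`. -/
def TraceBound {Z : Type*} (𝓕 : Set (Set Z)) (ι : Type*) (N : ℕ) : Prop :=
  ∀ p : ι → Z, ∃ 𝒜 : Finset (Finset ι), 𝒜.card ≤ N ∧ ∀ D ∈ 𝓕, ∃ A ∈ 𝒜, ∀ i, i ∈ A ↔ p i ∈ D

/-- The examples whose negative margin for `f` exceeds the threshold `c`. Equality counts for the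
label `-1` only, so that for `c = 0` these are the misclassified examples. -/
def overThreshold {X : Type*} (f : X → ℝ) (c : ℝ) : Set (X × Bool) :=
  {z | Errs (fun x => f x + c * sgn z.2) z}

lemma overThreshold_zero {X : Type*} (f : X → ℝ) : overThreshold f 0 = {z | Errs f z} := by
  ext z; simp [overThreshold]

lemma traceBound_overThreshold {X : Type*} {H : Set (X → ℝ)} (hbin : IsBinary H) {d : ℕ}
    (hvc : ∀ s : Finset X, Shatters H s → s.card ≤ d) (T : ℕ) (c : ℝ)
    (ι : Type*) [Fintype ι] :
    TraceBound {D | ∃ lam : H →₀ ℝ, lam.support.card ≤ T ∧ D = overThreshold (predictor H lam) c} ι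
      (((Fintype.card ι + 1) ^ d + 1) ^ T * (Fintype.card ι + 1) ^ (T + 1)) := by
  classical
  intro p
  -- The sign pattern of the offset scores on the sample determines the trace of the event.
  refine ⟨_, (Finset.card_image_le (f := fun A : Finset ι => Finset.univ.filter fun i =>
      ((p i).2 = true ∧ i ∉ A) ∨ ((p i).2 = false ∧ i ∈ A))).trans
    (card_sparse_patterns hbin hvc T (fun i => (p i).1) (fun i => c * sgn (p i).2)), ?_⟩
  rintro _ ⟨lam, hlam, rfl⟩
  refine ⟨_, Finset.mem_image.2 ⟨Finset.univ.filter fun i =>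
    0 ≤ predictor H lam (p i).1 + c * sgn (p i).2, ?_, rfl⟩, fun i => ?_⟩
  · exact Finset.mem_filter.2 ⟨Finset.mem_univ _, lam, hlam, by simp⟩
  · simp [overThreshold, Errs]

lemma Choices.card_support_iterate_le {X : Type*} {H : Set (X → ℝ)} (C : Choices X H) {m : ℕ}
    (S : Fin m → X × Bool) (t : ℕ) : (C.iterate m S t).support.card ≤ t := by
  classical
  induction t with
  | zero => simp [Choices.iterate]
  | succ t ih =>
    rw [Choices.iterate]
    refine (Finset.card_le_card Finsupp.support_add).trans ((Finset.card_union_le _ _).trans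
      (add_le_add ih ?_))
    refine (Finset.card_le_card Finsupp.support_smul).trans ?_
    exact (Finset.card_le_card Finsupp.support_single_subset).trans (by simp)


/-! ### Uniform deviations for measurable selections -/

section Symmetrization

variable {Z : Type*}

/-- Averaged over random signs, the exponential moment of the signed differences between two
samples is at most the number of traces times a Gaussian factor. The event `D σ` may depend on the
signs. -/
lemma sum_signs_exp_le {m N : ℕ} {𝓕 : Set (Set Z)} (hN : TraceBound 𝓕 (Fin m × Bool) N)
    (w : Fin m → Z × Z) (D : (Fin m → Bool) → Set Z) (hD : ∀ σ, D σ ∈ 𝓕) (s : ℝ) :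
    ∑ σ : Fin m → Bool, Real.exp (s * ∑ i, sgn (σ i) *
      ((D σ).indicator 1 (w i).1 - (D σ).indicator 1 (w i).2)) ≤
      2 ^ m * (N * Real.exp (m * s ^ 2 / 2)) := by
  classical
  obtain ⟨𝒜, hcard, h𝒜⟩ := hN fun q => if q.2 then (w q.1).1 else (w q.1).2
  let d : Finset (Fin m × Bool) → Fin m → ℝ := fun A i =>
    (if (i, true) ∈ A then 1 else 0) - (if (i, false) ∈ A then 1 else 0)
  have hd : ∀ A i, d A i ^ 2 ≤ 1 := fun A i => by
    dsimp only [d]; split_ifs <;> norm_num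
  have h1 : ∀ σ, Real.exp (s * ∑ i, sgn (σ i) *
      ((D σ).indicator 1 (w i).1 - (D σ).indicator 1 (w i).2)) ≤
      ∑ A ∈ 𝒜, Real.exp (s * ∑ i, sgn (σ i) * d A i) := by
    intro σ
    obtain ⟨A, hA, hAD⟩ := h𝒜 (D σ) (hD σ)
    refine le_trans (le_of_eq ?_) (Finset.single_le_sum
      (f := fun A => Real.exp (s * ∑ i, sgn (σ i) * d A i))
      (fun _ _ => (Real.exp_pos _).le) hA)
    congr 2
    refine Finset.sum_congr rfl fun i _ => ?_
    have e1 := hAD (i, true)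
    have e2 := hAD (i, false)
    simp only [if_true, Bool.false_eq_true, if_false] at e1 e2
    simp only [d, e1, e2, Set.indicator_apply, Pi.one_apply]
  have h2 : ∀ A, ∑ σ : Fin m → Bool, Real.exp (s * ∑ i, sgn (σ i) * d A i) ≤
      2 ^ m * Real.exp (m * s ^ 2 / 2) := by
    intro A
    have e : ∑ σ : Fin m → Bool, Real.exp (s * ∑ i, sgn (σ i) * d A i) =
        ∏ i, ∑ b : Bool, Real.exp (s * (sgn b * d A i)) := by
      rw [Finset.prod_univ_sum, Fintype.piFinset_univ]
      refine Finset.sum_congr rfl fun σ _ => ?_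
      rw [Finset.mul_sum, Real.exp_sum]
    rw [e]
    calc ∏ i : Fin m, ∑ b : Bool, Real.exp (s * (sgn b * d A i))
        ≤ ∏ _i : Fin m, (2 * Real.exp (s ^ 2 / 2)) := by
          refine Finset.prod_le_prod (fun i _ => Finset.sum_nonneg fun _ _ => (Real.exp_pos _).le)
            fun i _ => ?_
          have h3 := Real.cosh_le_exp_half_sq (s * d A i)
          have h4 : Real.exp ((s * d A i) ^ 2 / 2) ≤ Real.exp (s ^ 2 / 2) := by
            rw [Real.exp_le_exp, mul_pow]
            nlinarith [hd A i, sq_nonneg s]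
          rw [Real.cosh_eq] at h3
          simp only [Fintype.sum_bool, sgn, if_true, Bool.false_eq_true, if_false]
          rw [one_mul, show s * (-1 * d A i) = -(s * d A i) by ring]
          linarith
      _ = 2 ^ m * Real.exp (m * s ^ 2 / 2) := by
          rw [Finset.prod_const, Finset.card_univ, Fintype.card_fin, mul_pow, ← Real.exp_nat_mul,
            mul_div_assoc]
  calc _ ≤ ∑ σ : Fin m → Bool, ∑ A ∈ 𝒜, Real.exp (s * ∑ i, sgn (σ i) * d A i) :=
        Finset.sum_le_sum fun σ _ => h1 σ
    _ = ∑ A ∈ 𝒜, ∑ σ : Fin m → Bool, Real.exp (s * ∑ i, sgn (σ i) * d A i) := Finset.sum_comm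
    _ ≤ ∑ A ∈ 𝒜, 2 ^ m * Real.exp (m * s ^ 2 / 2) := Finset.sum_le_sum fun A _ => h2 A
    _ = (𝒜.card : ℝ) * (2 ^ m * Real.exp (m * s ^ 2 / 2)) := by rw [Finset.sum_const, nsmul_eq_mul]
    _ ≤ N * (2 ^ m * Real.exp (m * s ^ 2 / 2)) := by
        gcongr
    _ = _ := by ring

/-- Exchange of the two copies of the coordinates where `σ` is `false`. -/
def swapCoords {m : ℕ} (σ : Fin m → Bool) (w : Fin m → Z × Z) (i : Fin m) : Z × Z :=
  if σ i then w i else (w i).swap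

lemma indicator_one_mem_Icc (A : Set Z) (z : Z) :
    A.indicator (1 : Z → ℝ) z ∈ Set.Icc (0 : ℝ) 1 := by
  by_cases h : z ∈ A <;> simp [h]

lemma abs_sum_le_card {m : ℕ} {u : Fin m → ℝ} (h : ∀ i, |u i| ≤ 1) : |∑ i, u i| ≤ m := by
  refine (Finset.abs_sum_le_sum_abs _ _).trans ((Finset.sum_le_sum fun i _ => h i).trans ?_)
  simp

lemma abs_indicator_sub_le (A : Set Z) (z z' : Z) :
    |A.indicator (1 : Z → ℝ) z - A.indicator 1 z'| ≤ 1 := by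
  have h1 := indicator_one_mem_Icc A z
  have h2 := indicator_one_mem_Icc A z'
  rw [abs_le]
  constructor <;> linarith [h1.1, h1.2, h2.1, h2.2]

variable [MeasurableSpace Z] (μ : Measure Z)

variable {m : ℕ} (D : (Fin m → Z) → Set Z)

/-- The empirical count of the event `D S` selected by means of the sample `S`, minus its
expectation. -/
noncomputable def selDev (S : Fin m → Z) : ℝ :=
  ∑ i, ((D S).indicator 1 (S i) - μ.real (D S))

/-- The deviation depends on the selection rule only through the event it selects. -/
lemma selDev_eq_const (S : Fin m → Z) : selDev μ D S = selDev μ (fun _ => D S) S := rfl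

variable {D} [IsProbabilityMeasure μ]

lemma measurePreserving_swapCoords (σ : Fin m → Bool) :
    MeasurePreserving (swapCoords (Z := Z) σ) (Measure.pi fun _ => μ.prod μ)
      (Measure.pi fun _ => μ.prod μ) := by
  refine measurePreserving_pi (f := fun i (q : Z × Z) => if σ i then q else q.swap) _ _ fun i => ?_
  cases σ i
  · simpa using Measure.measurePreserving_swap
  · exact MeasurePreserving.id (μ.prod μ)

lemma measurable_selected (hD : MeasurableSet {q : (Fin m → Z) × Z | q.2 ∈ D q.1})
    {α : Type*} [MeasurableSpace α] {u : α → Fin m → Z} {v : α → Z} (hu : Measurable u)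
    (hv : Measurable v) : Measurable fun a => (D (u a)).indicator (1 : Z → ℝ) (v a) := by
  have : (fun a => (D (u a)).indicator (1 : Z → ℝ) (v a)) =
      Set.indicator ((fun a => (u a, v a)) ⁻¹' {q : (Fin m → Z) × Z | q.2 ∈ D q.1}) 1 := by
    classical
    ext a
    simp only [Set.indicator_apply]
    rfl
  rw [this]
  exact measurable_one.indicator ((hu.prodMk hv) hD)

lemma measurableSet_section (hD : MeasurableSet {q : (Fin m → Z) × Z | q.2 ∈ D q.1})
    (S : Fin m → Z) : MeasurableSet (D S) :=
  measurable_prodMk_left (x := S) hD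

lemma measurable_real_section (hD : MeasurableSet {q : (Fin m → Z) × Z | q.2 ∈ D q.1}) :
    Measurable fun S => μ.real (D S) :=
  (measurable_measure_prodMk_left hD).ennreal_toReal

lemma measurable_selDev (hD : MeasurableSet {q : (Fin m → Z) × Z | q.2 ∈ D q.1}) :
    Measurable (selDev μ D) :=
  Finset.measurable_sum _ fun i _ => (measurable_selected hD measurable_id
    (measurable_pi_apply i)).sub (measurable_real_section μ hD)

lemma abs_selDev_le (S : Fin m → Z) : |selDev μ D S| ≤ m := by
  refine abs_sum_le_card fun i => ?_
  have h1 := indicator_one_mem_Icc (D S) (S i)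
  have h2 : μ.real (D S) ≤ 1 := measureReal_le_one
  have h3 : 0 ≤ μ.real (D S) := measureReal_nonneg
  rw [abs_le]
  constructor <;> linarith [h1.1, h1.2]

lemma integrable_exp_mul {α : Type*} [MeasurableSpace α] {ν : Measure α} [IsFiniteMeasure ν]
    {f : α → ℝ} (hf : Measurable f) {c : ℝ} (hc : ∀ a, |f a| ≤ c) (s : ℝ) :
    Integrable (fun a => Real.exp (s * f a)) ν := by
  refine Integrable.of_bound (by fun_prop) (Real.exp (|s| * c)) (ae_of_all _ fun a => ?_)
  rw [Real.norm_eq_abs, Real.abs_exp, Real.exp_le_exp]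
  refine (le_abs_self _).trans ?_
  rw [abs_mul]
  exact mul_le_mul_of_nonneg_left (hc a) (abs_nonneg _)

/-- Symmetrization: Jensen's inequality replaces the expectation by a second sample, and the
exchangeability of the two samples introduces random signs. Only the pointwise bound
`sum_signs_exp_le` sees the whole family, which spares the measurability of suprema. -/
lemma integral_exp_selDev_le {𝓕 : Set (Set Z)} {N : ℕ} (hN : TraceBound 𝓕 (Fin m × Bool) N)
    (hD : MeasurableSet {q : (Fin m → Z) × Z | q.2 ∈ D q.1}) (hDF : ∀ S, D S ∈ 𝓕) (s : ℝ) :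
    ∫ S, Real.exp (s * selDev μ D S) ∂(Measure.pi fun _ : Fin m => μ) ≤
      N * Real.exp (m * s ^ 2 / 2) := by
  set π : Measure (Fin m → Z) := Measure.pi fun _ => μ with hπ
  let g : (Fin m → Z) × (Fin m → Z) → ℝ := fun q =>
    ∑ i, ((D q.1).indicator 1 (q.1 i) - (D q.1).indicator 1 (q.2 i))
  have hgm : Measurable g := Finset.measurable_sum _ fun i _ =>
    (measurable_selected hD measurable_fst ((measurable_pi_apply i).comp measurable_fst)).sub
      (measurable_selected hD measurable_fst ((measurable_pi_apply i).comp measurable_snd))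
  have hgb : ∀ q, |g q| ≤ m := fun q => abs_sum_le_card fun i => abs_indicator_sub_le _ _ _
  have hsec : ∀ S, Measurable fun S' => g (S, S') := fun S => hgm.comp measurable_prodMk_left
  have hmean : ∀ S, ∫ S', g (S, S') ∂π = selDev μ D S := by
    intro S
    have hint : ∀ i, Integrable (fun S' : Fin m → Z => (D S).indicator (1 : Z → ℝ) (S' i)) π := by
      intro i
      refine Integrable.of_bound ((measurable_selected hD measurable_const
        (measurable_pi_apply i)).aestronglyMeasurable) 1 (ae_of_all _ fun S' => ?_)
      have := indicator_one_mem_Icc (D S) (S' i)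
      rw [Real.norm_eq_abs, abs_of_nonneg this.1]
      exact this.2
    have hval : ∀ i, ∫ S', (D S).indicator (1 : Z → ℝ) (S' i) ∂π = μ.real (D S) := by
      intro i
      have hp := measurePreserving_eval (fun _ : Fin m => μ) i
      rw [← integral_indicator_one (μ := μ) (measurableSet_section hD S), ← hp.map_eq,
        integral_map hp.measurable.aemeasurable
          (measurable_one.indicator (measurableSet_section hD S)).aestronglyMeasurable]
    have hint' : ∀ i, Integrable (fun S' : Fin m → Z =>
        (D S).indicator (1 : Z → ℝ) (S i) - (D S).indicator 1 (S' i)) π := fun i =>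
      (integrable_const _).sub (hint i)
    dsimp only [g]
    rw [integral_finsetSum _ fun i _ => hint' i]
    refine Finset.sum_congr rfl fun i _ => ?_
    rw [integral_sub (integrable_const _) (hint i), hval]
    simp
  have hjensen : ∀ S, Real.exp (s * selDev μ D S) ≤ ∫ S', Real.exp (s * g (S, S')) ∂π := by
    intro S
    rw [← hmean, ← integral_const_mul]
    refine convexOn_exp.map_integral_le Real.continuous_exp.continuousOn isClosed_univ
      (ae_of_all _ fun _ => Set.mem_univ _) ?_ ?_
    · refine Integrable.const_mul ?_ s
      exact Integrable.of_bound (hsec S).aestronglyMeasurable m (ae_of_all _ fun S' => hgb _)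
    · exact integrable_exp_mul (hsec S) (fun S' => hgb _) s
  have hexp := integrable_exp_mul (ν := π.prod π) hgm hgb s
  have h1 : ∫ S, Real.exp (s * selDev μ D S) ∂π ≤ ∫ q, Real.exp (s * g q) ∂(π.prod π) := by
    rw [integral_prod _ hexp]
    exact integral_mono (integrable_exp_mul (measurable_selDev μ hD) (abs_selDev_le μ) s)
      hexp.integral_prod_left hjensen
  refine h1.trans ?_
  set Q : Measure (Fin m → Z × Z) := Measure.pi fun _ => μ.prod μ with hQ
  let Φ : (Fin m → Z × Z) → ℝ := fun w => Real.exp (s * g (fun i => (w i).1, fun i => (w i).2))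
  have hpair : Measurable fun w : Fin m → Z × Z => (fun i => (w i).1, fun i => (w i).2) := by
    fun_prop
  have hΦm : Measurable Φ := Real.measurable_exp.comp ((hgm.comp hpair).const_mul s)
  have h2 : ∫ q, Real.exp (s * g q) ∂(π.prod π) = ∫ w, Φ w ∂Q :=
    ((measurePreserving_arrowProdEquivProdArrow Z Z (Fin m) (fun _ => μ)
      (fun _ => μ)).integral_comp' _).symm
  have h3 : ∀ σ : Fin m → Bool, ∫ w, Φ (swapCoords σ w) ∂Q = ∫ w, Φ w ∂Q := by
    intro σ
    have hp := measurePreserving_swapCoords μ σ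
    have := integral_map (μ := Q) hp.measurable.aemeasurable (hΦm.aestronglyMeasurable)
    rw [hp.map_eq] at this
    exact this.symm
  have hint : ∀ σ : Fin m → Bool, Integrable (fun w => Φ (swapCoords σ w)) Q := fun σ =>
    integrable_exp_mul (ν := Q) (f := fun w =>
      g (fun i => (swapCoords σ w i).1, fun i => (swapCoords σ w i).2))
      (hgm.comp (hpair.comp (measurePreserving_swapCoords μ σ).measurable)) (fun w => hgb _) s
  have h4 : 2 ^ m * ∫ w, Φ w ∂Q = ∫ w, ∑ σ : Fin m → Bool, Φ (swapCoords σ w) ∂Q := by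
    rw [integral_finsetSum _ fun σ _ => hint σ]
    simp only [h3]
    simp
  have h5 : ∀ w, ∑ σ : Fin m → Bool, Φ (swapCoords σ w) ≤
      2 ^ m * (N * Real.exp (m * s ^ 2 / 2)) := by
    intro w
    refine le_trans (le_of_eq ?_) (sum_signs_exp_le hN w
      (fun σ => D fun i => (swapCoords σ w i).1) (fun σ => hDF _) s)
    refine Finset.sum_congr rfl fun σ _ => ?_
    dsimp only [Φ, g]
    congr 2
    refine Finset.sum_congr rfl fun i _ => ?_
    generalize (D fun i => (swapCoords σ w i).1) = A
    unfold swapCoords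
    cases σ i <;> simp [sgn]
  have h6 : 2 ^ m * ∫ w, Φ w ∂Q ≤ 2 ^ m * (N * Real.exp (m * s ^ 2 / 2)) := by
    rw [h4]
    refine (integral_mono (integrable_finsetSum _ fun σ _ => hint σ) (integrable_const _) h5).trans
      (le_of_eq ?_)
    simp
  rw [h2]
  exact le_of_mul_le_mul_left h6 (by positivity)

lemma measureReal_abs_selDev_le {𝓕 : Set (Set Z)} {N : ℕ}
    (hN : TraceBound 𝓕 (Fin m × Bool) N)
    (hD : MeasurableSet {q : (Fin m → Z) × Z | q.2 ∈ D q.1}) (hDF : ∀ S, D S ∈ 𝓕) {ε : ℝ}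
    (hε : 0 ≤ ε) :
    (Measure.pi fun _ : Fin m => μ).real {S | m * ε ≤ |selDev μ D S|} ≤
      2 * (N * Real.exp (-(m * ε ^ 2 / 2))) := by
  set π : Measure (Fin m → Z) := Measure.pi fun _ => μ with hπ
  have hint := integrable_exp_mul (ν := π) (measurable_selDev μ hD) (abs_selDev_le μ)
  have h1 := measure_ge_le_exp_mul_mgf (X := selDev μ D) (m * ε) hε (hint ε)
  have h2 := measure_le_le_exp_mul_mgf (X := selDev μ D) (-(m * ε)) (neg_nonpos.2 hε) (hint (-ε))
  have key : ∀ s : ℝ, s ^ 2 = ε ^ 2 → Real.exp (-(m * ε ^ 2)) * mgf (selDev μ D) π s ≤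
      N * Real.exp (-(m * ε ^ 2 / 2)) := by
    intro s hs
    have := integral_exp_selDev_le μ hN hD hDF s
    calc Real.exp (-(m * ε ^ 2)) * mgf (selDev μ D) π s
        ≤ Real.exp (-(m * ε ^ 2)) * (N * Real.exp (m * s ^ 2 / 2)) :=
          mul_le_mul_of_nonneg_left this (Real.exp_pos _).le
      _ = N * (Real.exp (-(m * ε ^ 2)) * Real.exp (m * s ^ 2 / 2)) := by ring
      _ = _ := by rw [← Real.exp_add, hs]; congr 2; ring
  have hsub : {S | m * ε ≤ |selDev μ D S|} ⊆
      {S | m * ε ≤ selDev μ D S} ∪ {S | selDev μ D S ≤ -(m * ε)} := by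
    intro S hS
    rcases le_abs.1 (show m * ε ≤ |selDev μ D S| from hS) with h | h
    · exact .inl h
    · exact .inr (by simp only [Set.mem_ofPred_eq]; linarith)
  refine (measureReal_mono hsub).trans ((measureReal_union_le _ _).trans ?_)
  have k1 := key ε rfl
  have k2 := key (-ε) (neg_sq ε)
  rw [show -ε * (m * ε) = -(m * ε ^ 2) by ring] at h1
  rw [show -(-ε) * (-(m * ε)) = -(m * ε ^ 2) by ring] at h2
  linarith

end Symmetrization

/-! ### Almost sure convergence of the deviations -/

/-- The polynomial trace bounds of sparse combinations, with the sparsity `⌈m ^ a⌉` for `a < 1`,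
are negligible against the exponential tail. -/
lemma summable_traces_mul_exp {a : ℝ} (ha0 : 0 < a) (ha1 : a < 1) (d : ℕ) {ε : ℝ} (hε : 0 < ε) :
    Summable fun m : ℕ => 2 * (((((2 * m + 1) ^ d + 1) ^ ⌈(m : ℝ) ^ a⌉₊ *
      (2 * m + 1) ^ (⌈(m : ℝ) ^ a⌉₊ + 1) : ℕ) : ℝ) * Real.exp (-(m * ε ^ 2 / 2))) := by
  have hg : Summable fun m : ℕ => 2 * Real.exp (m * -(ε ^ 2 / 4)) :=
    (Real.summable_exp_nat_mul_iff.2 (by nlinarith [sq_pos_of_pos hε])).mul_left 2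
  refine Summable.of_norm_bounded_eventually_nat hg ?_
  set b := (1 - a) / 2 with hb
  have hb0 : 0 < b := by rw [hb]; linarith
  set K : ℝ := (2 * d + 5) * (4 ^ b / b) with hK
  have hK0 : 0 < K := by positivity
  have hlim : Tendsto (fun m : ℕ => (m : ℝ) ^ (-(1 - (a + b)))) atTop (𝓝 0) :=
    (tendsto_rpow_neg_atTop (by rw [hb]; linarith)).comp tendsto_natCast_atTop_atTop
  filter_upwards [hlim.eventually_le_const (show 0 < ε ^ 2 / 4 / K by positivity),
    eventually_ge_atTop 1] with m hm hm1
  have hmR : (1 : ℝ) ≤ m := by exact_mod_cast hm1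
  have hm0 : (0 : ℝ) < m := by linarith
  set T := ⌈(m : ℝ) ^ a⌉₊ with hT
  have hTm : (T : ℝ) ≤ (m : ℝ) ^ a + 1 := (Nat.ceil_lt_add_one (by positivity)).le
  have hma : 1 ≤ (m : ℝ) ^ a := Real.one_le_rpow hmR ha0.le
  have hbase : (2 * m + 1) ^ d + 1 ≤ (2 * m + 2) ^ (d + 1) := by
    have h1 : (2 * m + 1) ^ d ≤ (2 * m + 2) ^ d := Nat.pow_le_pow_left (by omega) d
    have h2 : 1 ≤ (2 * m + 2) ^ d := Nat.one_le_pow _ _ (by omega)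
    rw [pow_succ]
    nlinarith
  have hN : ((2 * m + 1) ^ d + 1) ^ T * (2 * m + 1) ^ (T + 1) ≤
      (2 * m + 2) ^ ((d + 1) * T + (T + 1)) := by
    rw [pow_add (2 * m + 2), pow_mul]
    exact Nat.mul_le_mul (Nat.pow_le_pow_left hbase _) (Nat.pow_le_pow_left (by omega) _)
  have hlog : Real.log (2 * m + 2) ≤ 4 ^ b / b * (m : ℝ) ^ b := by
    refine (Real.log_le_rpow_div (by positivity) hb0).trans ?_
    rw [div_mul_eq_mul_div, ← Real.mul_rpow (by norm_num) hm0.le]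
    gcongr
    linarith
  have hlog0 : 0 ≤ Real.log (2 * m + 2) := Real.log_nonneg (by linarith)
  have hq : (((d + 1) * T + (T + 1) : ℕ) : ℝ) ≤ (2 * d + 5) * (m : ℝ) ^ a := by
    push_cast
    nlinarith [(Nat.cast_nonneg d : (0 : ℝ) ≤ d)]
  have hexp : (((d + 1) * T + (T + 1) : ℕ) : ℝ) * Real.log (2 * m + 2) ≤ m * (ε ^ 2 / 4) := by
    calc _ ≤ ((2 * d + 5) * (m : ℝ) ^ a) * (4 ^ b / b * (m : ℝ) ^ b) := by gcongr
      _ = K * (m : ℝ) ^ (a + b) := by rw [Real.rpow_add hm0, hK]; ring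
      _ = K * ((m : ℝ) ^ (-(1 - (a + b))) * m) := by
          rw [← Real.rpow_add_one hm0.ne']; congr 2; ring
      _ ≤ K * (ε ^ 2 / 4 / K * m) := by gcongr
      _ = m * (ε ^ 2 / 4) := by field_simp
  have hNr : ((((2 * m + 1) ^ d + 1) ^ T * (2 * m + 1) ^ (T + 1) : ℕ) : ℝ) ≤
      Real.exp (m * (ε ^ 2 / 4)) := by
    calc _ ≤ (((2 * m + 2) ^ ((d + 1) * T + (T + 1)) : ℕ) : ℝ) := by exact_mod_cast hN
      _ = Real.exp ((((d + 1) * T + (T + 1) : ℕ) : ℝ) * Real.log (2 * m + 2)) := by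
          rw [Real.exp_nat_mul, Real.exp_log (by positivity)]
          push_cast
          ring
      _ ≤ _ := Real.exp_le_exp.2 hexp
  rw [Real.norm_eq_abs, abs_of_nonneg (by positivity)]
  calc _ ≤ 2 * (Real.exp (m * (ε ^ 2 / 4)) * Real.exp (-(m * ε ^ 2 / 2))) := by gcongr
    _ = _ := by rw [← Real.exp_add]; congr 2; ring

section BorelCantelli

variable {Z Ω : Type*} [MeasurableSpace Z] {μ : Measure Z}
  [MeasurableSpace Ω] {P : Measure Ω} [IsProbabilityMeasure P] {ζ : ℕ → Ω → Z}

lemma map_sample (hζ : ∀ i, Measurable (ζ i)) (hlaw : ∀ i, P.map (ζ i) = μ)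
    (hindep : iIndepFun ζ P) (m : ℕ) :
    P.map (fun ω (i : Fin m) => ζ i ω) = Measure.pi fun _ => μ := by
  have h := hindep.precomp (g := fun i : Fin m => (i : ℕ)) Fin.val_injective
  have := (iIndepFun_iff_map_fun_eq_pi_map fun i => (hζ _).aemeasurable).1 h
  simp only [hlaw] at this
  exact this

variable [IsProbabilityMeasure μ]

/-- The empirical frequencies of measurably selected events approach their probabilities, if the
number of traces is dominated by the exponential tail. -/
lemma ae_tendsto_selDev (hζ : ∀ i, Measurable (ζ i)) (hlaw : ∀ i, P.map (ζ i) = μ)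
    (hindep : iIndepFun ζ P) {D : (m : ℕ) → (Fin m → Z) → Set Z}
    (hD : ∀ m, MeasurableSet {q : (Fin m → Z) × Z | q.2 ∈ D m q.1}) {𝓕 : ℕ → Set (Set Z)}
    {N : ℕ → ℕ} (hN : ∀ m, 1 ≤ m → TraceBound (𝓕 m) (Fin m × Bool) (N m))
    (hDF : ∀ m, 1 ≤ m → ∀ S, D m S ∈ 𝓕 m)
    (hsum : ∀ ε : ℝ, 0 < ε → Summable fun m : ℕ => 2 * ((N m : ℝ) * Real.exp (-(m * ε ^ 2 / 2)))) :
    ∀ᵐ ω ∂P, Tendsto (fun m : ℕ => (1 / (m : ℝ)) * selDev μ (D m) fun i => ζ i ω)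
      atTop (𝓝 0) := by
  have hε : ∀ ε : ℝ, 0 < ε → ∀ᵐ ω ∂P, ∀ᶠ m : ℕ in atTop,
      |(1 / (m : ℝ)) * selDev μ (D m) fun i => ζ i ω| < ε := by
    intro ε hε
    let E : ℕ → Set Ω := fun m => {ω | 1 ≤ m ∧ m * ε ≤ |selDev μ (D m) fun i => ζ i ω|}
    have hE : ∀ m, P (E m) ≤
        ENNReal.ofReal (2 * ((N m : ℝ) * Real.exp (-(m * ε ^ 2 / 2)))) := by
      intro m
      rcases Nat.eq_zero_or_pos m with rfl | hm
      · simp [E]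
      have hmeas : MeasurableSet {S : Fin m → Z | m * ε ≤ |selDev μ (D m) S|} :=
        measurableSet_le measurable_const (measurable_selDev μ (hD m)).abs
      have hsm : Measurable fun ω (i : Fin m) => ζ i ω := measurable_pi_lambda _ fun i => hζ i
      calc P (E m) ≤ P ((fun ω (i : Fin m) => ζ i ω) ⁻¹' {S | m * ε ≤ |selDev μ (D m) S|}) :=
            measure_mono fun ω hω => hω.2
        _ = (Measure.pi fun _ : Fin m => μ) {S | m * ε ≤ |selDev μ (D m) S|} := by
            rw [← Measure.map_apply hsm hmeas, map_sample hζ hlaw hindep]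
        _ ≤ _ := by
            rw [ENNReal.le_ofReal_iff_toReal_le (measure_ne_top _ _) (by positivity)]
            exact measureReal_abs_selDev_le μ (hN m hm) (hD m) (hDF m hm) hε.le
    have hfin : ∑' m, P (E m) ≠ ⊤ :=
      ne_top_of_le_ne_top (hsum ε hε).tsum_ofReal_ne_top (ENNReal.tsum_le_tsum hE)
    filter_upwards [ae_eventually_notMem hfin] with ω hω
    filter_upwards [hω, eventually_ge_atTop 1] with m hm hm1
    have hm0 : (0 : ℝ) < m := by exact_mod_cast hm1
    rw [abs_mul, abs_of_pos (by positivity), one_div, inv_mul_lt_iff₀ hm0]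
    by_contra hc
    exact hm ⟨hm1, not_lt.1 hc⟩
  have hall : ∀ᵐ ω ∂P, ∀ k : ℕ, ∀ᶠ m : ℕ in atTop,
      |(1 / (m : ℝ)) * selDev μ (D m) fun i => ζ i ω| < 1 / ((k : ℝ) + 1) :=
    ae_all_iff.2 fun k => hε _ (by positivity)
  filter_upwards [hall] with ω hω
  rw [Metric.tendsto_nhds]
  intro ε hε
  obtain ⟨k, hk⟩ := exists_nat_one_div_lt hε
  filter_upwards [hω k] with m hm
  rw [Real.dist_0_eq_abs]
  exact hm.trans hk

end BorelCantelli


/-! ### Surrogate risk and classification risk -/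

section Calibration

variable {X : Type*} {ℓ : ℝ → ℝ}

/-- Shift of the score `f` by `t` towards the classifier `g` where the two disagree. -/
noncomputable def nudge (f : X → ℝ) (g : X → Bool) (t : ℝ) (x : X) : ℝ :=
  if 0 ≤ f x then (if g x then f x else f x - t) else (if g x then f x + t else f x)

open Classical in
/-- The nudge changes the loss at least as much as the classification error changes when `f` is
replaced by `g`, up to an error of second order. -/
lemma loss_sub_nudge (hℓ : IsLbds ℓ) (f : X → ℝ) (g : X → Bool) {t : ℝ} (ht : 0 < t)
    (z : X × Bool) :
    t * deriv ℓ 0 * ((if Errs f z then 1 else 0) - (if g z.1 ≠ z.2 then 1 else 0)) -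
        gradLip ℓ * t ^ 2 ≤
      ℓ (-(sgn z.2) * f z.1) - ℓ (-(sgn z.2) * nudge f g t z.1) := by
  obtain ⟨x, y⟩ := z
  have hup := hℓ.gradLip_bound ht.le
  have hdown := hℓ.gradLip_bound (show -t ≤ 0 by linarith)
  have hB : 0 ≤ gradLip ℓ * t ^ 2 := by
    have h1 := hℓ.mono_deriv ht.le
    nlinarith
  -- By convexity, lowering a nonnegative argument of the loss by `t` gains at least as much,
  -- and raising a nonpositive one by `t` costs at most as much, as the same move starting from `0`.
  have gain : ∀ v : ℝ, 0 ≤ v → t * deriv ℓ 0 - gradLip ℓ * t ^ 2 ≤ ℓ v - ℓ (v - t) := by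
    intro v hv
    have h1 := hℓ.tangent (v - t) v
    have h2 := hℓ.mono_deriv (show -t ≤ v - t by linarith)
    nlinarith
  have loss : ∀ v : ℝ, v ≤ 0 → -(t * deriv ℓ 0) - gradLip ℓ * t ^ 2 ≤ ℓ v - ℓ (v + t) := by
    intro v hv
    have h1 := hℓ.tangent (v + t) v
    have h2 := hℓ.mono_deriv (show v + t ≤ t by linarith)
    nlinarith
  rcases le_or_gt 0 (f x) with h0 | h0
  · cases hg : g x <;> cases y
    · simpa [nudge, h0, hg, Errs, sgn] using gain _ h0
    · have := loss (-f x) (by linarith)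
      simp only [nudge, h0, hg, Errs, sgn, not_lt.2 h0]
      simp
      rw [show t - f x = -f x + t by ring]
      linarith
    · simpa [nudge, h0, hg, Errs, sgn] using hB
    · simpa [nudge, h0, hg, Errs, sgn, not_lt.2 h0] using hB
  · cases hg : g x <;> cases y
    · simpa [nudge, h0, hg, Errs, sgn, not_le.2 h0] using hB
    · simpa [nudge, h0, hg, Errs, sgn, not_le.2 h0] using hB
    · have := loss (f x) h0.le
      simp only [nudge, h0, hg, Errs, sgn, not_le.2 h0]
      simp
      linarith
    · have := gain (-f x) (by linarith)
      simp only [nudge, h0, hg, Errs, sgn, not_le.2 h0]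
      simp
      rw [show -t + -f x = -f x - t by ring]
      linarith

variable {H : Set (X → ℝ)}

lemma exists_abs_predictor_le (hbin : IsBinary H) (lam : H →₀ ℝ) :
    ∃ c : ℝ, ∀ x, |predictor H lam x| ≤ c := by
  refine ⟨lam.sum fun _ c => |c|, fun x => (Finset.abs_sum_le_sum_abs _ _).trans
    (Finset.sum_le_sum fun h _ => ?_)⟩
  rw [abs_mul]
  rcases hbin h h.2 x with e | e <;> rw [e] <;> simp

variable [MeasurableSpace X] (μ : Measure (X × Bool))

/-- The surrogate risk of the score function `f`. -/
noncomputable def surrRisk (ℓ : ℝ → ℝ) (μ : Measure (X × Bool)) (f : X → ℝ) : ℝ :=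
  ∫ z, ℓ (-(sgn z.2) * f z.1) ∂μ

lemma measurable_sgn : Measurable sgn := Measurable.of_discrete

lemma abs_neg_sgn_mul (y : Bool) (r : ℝ) : |-(sgn y) * r| = |r| := by
  cases y <;> simp [sgn]

lemma measurable_loss (hℓ : IsLbds ℓ) {f : X → ℝ} (hf : Measurable f) :
    Measurable fun z : X × Bool => ℓ (-(sgn z.2) * f z.1) :=
  hℓ.continuous.measurable.comp
    ((measurable_sgn.comp measurable_snd).neg.mul (hf.comp measurable_fst))

lemma loss_le_of_abs_le (hℓ : IsLbds ℓ) {c r : ℝ} (y : Bool) (h : |r| ≤ c) :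
    ℓ (-(sgn y) * r) ≤ ℓ c :=
  hℓ.monotone ((le_abs_self _).trans ((abs_neg_sgn_mul y r).le.trans h))

lemma measurableSet_overThreshold {f : X → ℝ} (hf : Measurable f) (c : ℝ) :
    MeasurableSet (overThreshold f c) := by
  have hy : ∀ b : Bool, MeasurableSet {z : X × Bool | z.2 = b} := fun b =>
    measurable_snd (measurableSet_singleton b)
  have hu : Measurable fun z : X × Bool => f z.1 + c * sgn z.2 :=
    (hf.comp measurable_fst).add ((measurable_sgn.comp measurable_snd).const_mul c)
  exact ((hy true).inter (measurableSet_lt hu measurable_const)).union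
    ((hy false).inter (measurableSet_le measurable_const hu))

lemma surrRisk_nonneg (hℓ : IsLbds ℓ) (f : X → ℝ) : 0 ≤ surrRisk ℓ μ f :=
  integral_nonneg fun _ => hℓ.nonneg _

lemma bayesRisk_le_risk {f : X → ℝ} (hf : Measurable f) : bayesRisk μ ≤ risk μ f := by
  classical
  have hg : Measurable fun x => decide (0 ≤ f x) := by
    refine measurable_to_bool ?_
    have : (fun x => decide (0 ≤ f x)) ⁻¹' {true} = {x | 0 ≤ f x} := by ext; simp
    rw [this]
    exact measurableSet_le measurable_const hf
  have hb : BddBelow (Set.range fun g : {g : X → Bool // Measurable g} =>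
      μ.real {z | g.1 z.1 ≠ z.2}) := ⟨0, by rintro _ ⟨g, rfl⟩; exact measureReal_nonneg⟩
  refine (ciInf_le hb ⟨_, hg⟩).trans (le_of_eq ?_)
  unfold risk
  congr 1
  ext ⟨x, y⟩
  cases y <;> simp [Errs]

variable [IsProbabilityMeasure μ]

lemma integrable_loss (hℓ : IsLbds ℓ) {f : X → ℝ} (hf : Measurable f) {c : ℝ}
    (hc : ∀ x, |f x| ≤ c) : Integrable (fun z : X × Bool => ℓ (-(sgn z.2) * f z.1)) μ := by
  refine Integrable.of_bound (measurable_loss hℓ hf).aestronglyMeasurable (ℓ c)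
    (ae_of_all _ fun z => ?_)
  rw [Real.norm_eq_abs, abs_of_nonneg (hℓ.nonneg _)]
  exact loss_le_of_abs_le hℓ _ (hc _)

lemma measurable_nudge {f : X → ℝ} {g : X → Bool} (hf : Measurable f) (hg : Measurable g)
    (t : ℝ) : Measurable (nudge f g t) := by
  have hgt : MeasurableSet {x | g x = true} := hg (measurableSet_singleton true)
  exact Measurable.ite (measurableSet_le measurable_const hf)
    (Measurable.ite hgt hf (hf.sub_const t)) (Measurable.ite hgt (hf.add_const t) hf)

lemma risk_sub_le (hℓ : IsLbds ℓ) {f : X → ℝ} (hf : Measurable f) {c : ℝ}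
    (hc : ∀ x, |f x| ≤ c) {g : X → Bool} (hg : Measurable g) {t : ℝ} (ht : 0 < t) :
    t * deriv ℓ 0 * (risk μ f - μ.real {z | g z.1 ≠ z.2}) - gradLip ℓ * t ^ 2 ≤
      surrRisk ℓ μ f - surrRisk ℓ μ (nudge f g t) := by
  classical
  have hnb : ∀ x, |nudge f g t x| ≤ c + t := by
    intro x
    have h1 := abs_le.1 (hc x)
    rw [abs_le]
    unfold nudge
    split_ifs <;> constructor <;> linarith [h1.1, h1.2]
  have hE : MeasurableSet {z | Errs f z} := by
    rw [← overThreshold_zero]; exact measurableSet_overThreshold hf 0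
  have hG : MeasurableSet {z : X × Bool | g z.1 ≠ z.2} :=
    (measurableSet_eq_fun (hg.comp measurable_fst) measurable_snd).compl
  have i1 : Integrable ({z | Errs f z}.indicator (1 : X × Bool → ℝ)) μ :=
    (integrable_const 1).indicator hE
  have i2 : Integrable ({z : X × Bool | g z.1 ≠ z.2}.indicator (1 : X × Bool → ℝ)) μ :=
    (integrable_const 1).indicator hG
  have j1 := integrable_loss μ hℓ hf hc
  have j2 := integrable_loss μ hℓ (measurable_nudge hf hg t) hnb
  have k1 : Integrable (fun z => t * deriv ℓ 0 * ({z | Errs f z}.indicator (1 : X × Bool → ℝ) z -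
      {z : X × Bool | g z.1 ≠ z.2}.indicator 1 z)) μ := (i1.sub i2).const_mul _
  have main := integral_mono (μ := μ) (k1.sub (integrable_const (gradLip ℓ * t ^ 2)))
    (j1.sub j2) (fun z => by
      have := loss_sub_nudge hℓ f g ht z
      simpa [Set.indicator_apply] using this)
  simp only [Pi.sub_apply] at main
  rw [integral_sub k1 (integrable_const _), integral_sub j1 j2, integral_const_mul,
    integral_sub i1 i2, integral_indicator_one hE, integral_indicator_one hG] at main
  simpa [risk, surrRisk] using main

/-- Calibration: near-minimizers of the surrogate risk are near-minimizers of the classification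
risk. The competitor which shows it is a nudge of the score towards a good classifier. -/
lemma exists_calibration (hℓ : IsLbds ℓ) (h2 : IsLtd ℓ) {ε : ℝ} (hε : 0 < ε) :
    ∃ δ : ℝ, 0 < δ ∧ ∀ f : X → ℝ, Measurable f → (∃ c : ℝ, ∀ x, |f x| ≤ c) →
      (∀ f' : X → ℝ, Measurable f' → (∃ c : ℝ, ∀ x, |f' x| ≤ c) →
        surrRisk ℓ μ f ≤ surrRisk ℓ μ f' + δ) → risk μ f ≤ bayesRisk μ + ε := by
  obtain ⟨β, hβ, hβℓ⟩ := hℓ.deriv_lower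
  have hd : 0 < deriv ℓ 0 := hβ.trans_le (hβℓ 0 le_rfl)
  have hB := gradLip_pos hℓ h2
  set t := ε * deriv ℓ 0 / (2 * gradLip ℓ) with ht
  have ht0 : 0 < t := by positivity
  have hBt : gradLip ℓ * t = ε * deriv ℓ 0 / 2 := by rw [ht]; field_simp
  refine ⟨t * deriv ℓ 0 * (ε / 2), by positivity, fun f hf ⟨c, hc⟩ hopt => ?_⟩
  have : risk μ f - ε ≤ bayesRisk μ := by
    have : Nonempty {g : X → Bool // Measurable g} := ⟨⟨fun _ => true, measurable_const⟩⟩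
    refine le_ciInf fun ⟨g, hg⟩ => ?_
    have h3 := risk_sub_le μ hℓ hf hc hg ht0
    have h4 := hopt (nudge f g t) (measurable_nudge hf hg t) ⟨c + t, fun x => by
      have h1 := abs_le.1 (hc x)
      rw [abs_le]
      unfold nudge
      split_ifs <;> constructor <;> linarith [h1.1, h1.2]⟩
    have h5 : t * deriv ℓ 0 * (risk μ f - μ.real {z | g z.1 ≠ z.2}) ≤ t * deriv ℓ 0 * ε := by
      have : gradLip ℓ * t ^ 2 = t * deriv ℓ 0 * (ε / 2) := by rw [pow_two, ← mul_assoc, hBt]; ring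
      linarith
    have := le_of_mul_le_mul_left h5 (by positivity)
    linarith
  linarith

/-! ### Approximation by the span of the class -/

lemma measurable_predictor (hmeas : ∀ h ∈ H, Measurable h) (lam : H →₀ ℝ) :
    Measurable (predictor H lam) := by
  unfold predictor Finsupp.sum
  exact Finset.measurable_sum _ fun h _ => (hmeas h h.2).mul_const _

lemma exists_surrRisk_predictor_le (hℓ : IsLbds ℓ) (hbin : IsBinary H)
    (hmeas : ∀ h ∈ H, Measurable h) (hds : DenseSpan (μ.map Prod.fst) H) {f : X → ℝ}
    (hf : Measurable f) (hb : ∃ c : ℝ, ∀ x, |f x| ≤ c) {ε : ℝ} (hε : 0 < ε) :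
    ∃ lam : H →₀ ℝ, surrRisk ℓ μ (predictor H lam) ≤ surrRisk ℓ μ f + ε := by
  obtain ⟨K, hK0, hK⟩ := hℓ.exists_abs_sub_le
  obtain ⟨p, hp, hpf⟩ := hds f hf hb (ENNReal.ofReal (ε / K)) (by simpa using by positivity)
  obtain ⟨lam, hlam⟩ := (Finsupp.mem_span_iff_linearCombination ℝ H p).1 hp
  have hlp : predictor H lam = p := by
    rw [← hlam]
    ext x
    simp [predictor, Finsupp.linearCombination_apply, Finsupp.sum, mul_comm]
  refine ⟨lam, ?_⟩
  have hpm := measurable_predictor hmeas lam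
  obtain ⟨c, hc⟩ := exists_abs_predictor_le hbin lam
  obtain ⟨c', hc'⟩ := hb
  have i1 := integrable_loss μ hℓ hpm hc
  have i2 := integrable_loss μ hℓ hf hc'
  have hsub : Measurable fun x => predictor H lam x - f x := hpm.sub hf
  have hdist : ∫ z : X × Bool, |predictor H lam z.1 - f z.1| ∂μ ≤ ε / K := by
    have e : ∫ z : X × Bool, |predictor H lam z.1 - f z.1| ∂μ =
        (eLpNorm (fun x => predictor H lam x - f x) 1 (μ.map Prod.fst)).toReal := by
      rw [eLpNorm_one_eq_lintegral_enorm, ← integral_norm_eq_lintegral_enorm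
        hsub.aestronglyMeasurable, integral_map measurable_fst.aemeasurable
        hsub.norm.aestronglyMeasurable]
      rfl
    rw [e, hlp]
    refine (ENNReal.toReal_mono ENNReal.ofReal_ne_top hpf.le).trans (le_of_eq ?_)
    exact ENNReal.toReal_ofReal (by positivity)
  have hint : Integrable (fun z : X × Bool => |predictor H lam z.1 - f z.1|) μ := by
    refine Integrable.of_bound (hsub.comp measurable_fst).abs.aestronglyMeasurable (c + c')
      (ae_of_all _ fun z => ?_)
    rw [Real.norm_eq_abs, abs_abs]
    exact (abs_sub _ _).trans (add_le_add (hc _) (hc' _))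
  have hmono := integral_mono i1 (i2.add (hint.const_mul K)) (fun z => by
    have h1 := hK (-(sgn z.2) * predictor H lam z.1) (-(sgn z.2) * f z.1)
    rw [← mul_sub, abs_neg_sgn_mul] at h1
    have h2 := (le_abs_self _).trans h1
    simp only [Pi.add_apply]
    linarith)
  rw [integral_add' i2 (hint.const_mul K), integral_const_mul] at hmono
  have : K * ∫ z : X × Bool, |predictor H lam z.1 - f z.1| ∂μ ≤ ε := by
    calc _ ≤ K * (ε / K) := by gcongr
      _ = ε := by field_simp
  exact hmono.trans (by unfold surrRisk; linarith)

/-- Some finite combination of the class is nearly optimal among all bounded score functions. -/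
lemma exists_near_optimal (hℓ : IsLbds ℓ) (hbin : IsBinary H)
    (hmeas : ∀ h ∈ H, Measurable h) (hds : DenseSpan (μ.map Prod.fst) H) {ε : ℝ} (hε : 0 < ε) :
    ∃ lam : H →₀ ℝ, ∀ f : X → ℝ, Measurable f → (∃ c : ℝ, ∀ x, |f x| ≤ c) →
      surrRisk ℓ μ (predictor H lam) ≤ surrRisk ℓ μ f + ε := by
  let V : Set ℝ := {r | ∃ f : X → ℝ, Measurable f ∧ (∃ c : ℝ, ∀ x, |f x| ≤ c) ∧
    surrRisk ℓ μ f = r}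
  have hV : V.Nonempty := ⟨_, fun _ => 0, measurable_const, ⟨0, by simp⟩, rfl⟩
  have hVb : BddBelow V := ⟨0, by rintro _ ⟨f, _, _, rfl⟩; exact surrRisk_nonneg μ hℓ f⟩
  obtain ⟨_, ⟨f₀, hf₀, hb₀, rfl⟩, hlt⟩ := exists_lt_of_csInf_lt hV
    (show sInf V < sInf V + ε / 2 by linarith)
  obtain ⟨lam, hlam⟩ := exists_surrRisk_predictor_le μ hℓ hbin hmeas hds hf₀ hb₀ (half_pos hε)
  refine ⟨lam, fun f hf hb => ?_⟩
  have := csInf_le hVb ⟨f, hf, hb, rfl⟩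
  linarith

end Calibration

/-! ### Clipped scores and staircase approximation of the loss -/

section Clip

/-- The nearest point of `[a, b]` to `v`, for `a ≤ b`. -/
def clip (a b v : ℝ) : ℝ := max a (min b v)

lemma clip_symm_neg {s : ℝ} (hs : 0 ≤ s) (v : ℝ) : clip (-s) s (-v) = -clip (-s) s v := by
  unfold clip
  rcases le_total v s with h1 | h1 <;> rcases le_total (-s) v with h2 | h2
  · rw [min_eq_right h1, max_eq_right h2, min_eq_right (by linarith), max_eq_right (by linarith)]
  · rw [min_eq_right h1, max_eq_left h2, min_eq_left (by linarith), max_eq_right (by linarith)]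
    ring
  · rw [min_eq_left h1, max_eq_right (show -s ≤ s by linarith),
      min_eq_right (show -v ≤ s by linarith), max_eq_left (show -v ≤ -s by linarith)]
  · obtain rfl : s = 0 := by linarith
    obtain rfl : v = 0 := by linarith
    simp

lemma abs_clip_le {s : ℝ} (hs : 0 ≤ s) (v : ℝ) : |clip (-s) s v| ≤ s :=
  abs_le.2 ⟨le_max_left _ _, max_le (by linarith) (min_le_left _ _)⟩

lemma sgn_mul_clip {s : ℝ} (hs : 0 ≤ s) (y : Bool) (r : ℝ) :
    -(sgn y) * clip (-s) s r = clip (-s) s (-(sgn y) * r) := by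
  cases y
  · simp [sgn]
  · simp [sgn, clip_symm_neg hs]

lemma errs_clip {X : Type*} {s : ℝ} (hs : 0 < s) (f : X → ℝ) (z : X × Bool) :
    Errs (fun x => clip (-s) s (f x)) z ↔ Errs f z := by
  have h1 : 0 ≤ clip (-s) s (f z.1) ↔ 0 ≤ f z.1 := by
    unfold clip
    rw [le_max_iff, le_min_iff]
    constructor
    · rintro (h | h)
      · linarith
      · exact h.2
    · exact fun h => .inr ⟨hs.le, h⟩
  simp only [Errs, h1, ← not_le]

/-- Clipping increases the loss only where the loss is already near its infimum. -/
lemma IsLbds.exists_clip_le {ℓ : ℝ → ℝ} (hℓ : IsLbds ℓ) {ε : ℝ} (hε : 0 < ε) :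
    ∃ s : ℝ, 0 < s ∧ ∀ v, ℓ (clip (-s) s v) ≤ ℓ v + ε := by
  have hb : BddBelow (Set.range ℓ) := ⟨0, by rintro _ ⟨v, rfl⟩; exact hℓ.nonneg v⟩
  obtain ⟨_, ⟨v₀, rfl⟩, hv₀⟩ := exists_lt_of_csInf_lt (Set.range_nonempty ℓ)
    (show sInf (Set.range ℓ) < sInf (Set.range ℓ) + ε by linarith)
  refine ⟨|v₀| + 1, by positivity, fun v => ?_⟩
  have h1 : ℓ (-(|v₀| + 1)) ≤ ℓ v + ε := by
    have h2 := hℓ.monotone (show -(|v₀| + 1) ≤ v₀ by linarith [neg_abs_le v₀])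
    have h3 := csInf_le hb ⟨v, rfl⟩
    linarith
  unfold clip
  rcases le_total (-(|v₀| + 1)) (min (|v₀| + 1) v) with h | h
  · rw [max_eq_right h]
    linarith [hℓ.monotone (min_le_right (|v₀| + 1) v)]
  · rwa [max_eq_left h]

/-- A monotone function on an interval is uniformly close to a combination of indicators of upper
half-lines with end points on a fine grid; `b k` stands for the indicator at `c k`, whose value at
`c k` itself is arbitrary. -/
lemma staircase_approx {ℓ : ℝ → ℝ} (hℓ : Monotone ℓ) {c : ℕ → ℝ} (hc : StrictMono c) {η : ℝ}
    (hη : ∀ k, ℓ (c (k + 1)) - ℓ (c k) ≤ η) {v : ℝ} {b : ℕ → ℝ}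
    (hb : ∀ k, (b k = 1 ∧ c k ≤ v) ∨ (b k = 0 ∧ v ≤ c k)) (n : ℕ) :
    |ℓ (clip (c 0) (c n) v) -
      (ℓ (c 0) + ∑ k ∈ Finset.range n, (ℓ (c (k + 1)) - ℓ (c k)) * b (k + 1))| ≤ η := by
  have hη0 : 0 ≤ η := (sub_nonneg.2 (hℓ (hc.monotone (Nat.zero_le 1)))).trans (hη 0)
  induction n with
  | zero => simpa [clip] using hη0
  | succ n ih =>
    have hlt := hc (Nat.lt_succ_self n)
    rw [Finset.sum_range_succ]
    rcases le_or_gt v (c n) with hv | hv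
    · have hbn : b (n + 1) = 0 := by
        rcases hb (n + 1) with h | h
        · linarith [h.2]
        · exact h.1
      have e : clip (c 0) (c (n + 1)) v = clip (c 0) (c n) v := by
        unfold clip
        rw [min_eq_right hv, min_eq_right (by linarith)]
      rw [e, hbn, mul_zero, add_zero]
      exact ih
    · have hbk : ∀ k ∈ Finset.range n, (ℓ (c (k + 1)) - ℓ (c k)) * b (k + 1) =
          ℓ (c (k + 1)) - ℓ (c k) := by
        intro k hk
        have hkn := hc.monotone (show k + 1 ≤ n from Finset.mem_range.1 hk)
        rcases hb (k + 1) with h | h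
        · rw [h.1, mul_one]
        · linarith [h.2]
      rw [Finset.sum_congr rfl hbk, Finset.sum_range_sub fun k => ℓ (c k)]
      have h0 := hc.monotone (Nat.zero_le n)
      have e : clip (c 0) (c (n + 1)) v = min (c (n + 1)) v :=
        max_eq_right (le_min (by linarith) (by linarith))
      rw [e]
      have h1 := hℓ (show c n ≤ min (c (n + 1)) v from le_min hlt.le hv.le)
      have h2 := hℓ (min_le_left (c (n + 1)) v)
      have h3 := hη n
      rw [abs_le]
      rcases hb (n + 1) with h | h <;> rw [h.1] <;> constructor <;> linarith

open Classical in
lemma indicator_overThreshold {X : Type*} (f : X → ℝ) (z : X × Bool) (c : ℝ) :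
    ((overThreshold f c).indicator (1 : X × Bool → ℝ) z = 1 ∧ c ≤ -(sgn z.2) * f z.1) ∨
      ((overThreshold f c).indicator (1 : X × Bool → ℝ) z = 0 ∧ -(sgn z.2) * f z.1 ≤ c) := by
  obtain ⟨x, y⟩ := z
  by_cases h : (x, y) ∈ overThreshold f c
  · refine .inl ⟨by simp [h], ?_⟩
    cases y <;> simp [overThreshold, Errs, sgn] at h ⊢ <;> linarith
  · refine .inr ⟨by simp [h], ?_⟩
    cases y <;> simp [overThreshold, Errs, sgn] at h ⊢ <;> linarith

variable {X : Type*} [MeasurableSpace X] {ℓ : ℝ → ℝ} (μ : Measure (X × Bool))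
  [IsProbabilityMeasure μ]

/-- The surrogate risk of a clipped score exceeds its empirical counterpart by little, as soon as
finitely many threshold events have empirical frequencies close to their probabilities. -/
lemma exists_thresholds (hℓ : IsLbds ℓ) {s ε : ℝ} (hs : 0 < s) (hε : 0 < ε) :
    ∃ (n : ℕ) (c w : ℕ → ℝ), ∀ f : X → ℝ, Measurable f → ∀ m : ℕ, 1 ≤ m →
      ∀ S : Fin m → X × Bool,
      surrRisk ℓ μ (fun x => clip (-s) s (f x)) ≤
        (1 / (m : ℝ)) * ∑ i, ℓ (clip (-s) s (-(sgn (S i).2) * f (S i).1)) + ε -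
          ∑ k ∈ Finset.range n, w k * ((1 / (m : ℝ)) *
            selDev μ (fun _ : Fin m → X × Bool => overThreshold f (c k)) S) := by
  obtain ⟨K, hK0, hK⟩ := hℓ.exists_abs_sub_le
  obtain ⟨n, hn⟩ := exists_nat_gt (2 * s * K / (ε / 2))
  have hn0 : (0 : ℝ) < n := lt_of_le_of_lt (by positivity) hn
  set c : ℕ → ℝ := fun k => -s + k * (2 * s / n) with hcdef
  have hcm : StrictMono c := by
    refine strictMono_nat_of_lt_succ fun k => ?_
    have : 0 < 2 * s / n := by positivity
    simp only [hcdef]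
    push_cast
    linarith
  have hc0 : c 0 = -s := by simp [hcdef]
  have hcn : c n = s := by simp only [hcdef]; field_simp; ring
  have hη : ∀ k, ℓ (c (k + 1)) - ℓ (c k) ≤ ε / 2 := by
    intro k
    have h1 := (le_abs_self _).trans (hK (c (k + 1)) (c k))
    have h2 : c (k + 1) - c k = 2 * s / n := by simp only [hcdef]; push_cast; ring
    rw [h2, abs_of_pos (by positivity)] at h1
    refine h1.trans ?_
    rw [div_lt_iff₀ (by positivity)] at hn
    rw [← mul_div_assoc, div_le_iff₀ hn0]
    linarith
  refine ⟨n, fun k => c (k + 1), fun k => ℓ (c (k + 1)) - ℓ (c k), fun f hf m hm S => ?_⟩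
  have happrox : ∀ z : X × Bool, |ℓ (clip (-s) s (-(sgn z.2) * f z.1)) - (ℓ (-s) +
      ∑ k ∈ Finset.range n, (ℓ (c (k + 1)) - ℓ (c k)) *
        (overThreshold f (c (k + 1))).indicator 1 z)| ≤ ε / 2 := by
    intro z
    have := staircase_approx hℓ.monotone hcm hη (v := -(sgn z.2) * f z.1)
      (b := fun k => (overThreshold f (c k)).indicator 1 z)
      (fun k => indicator_overThreshold f z (c k)) n
    rwa [hc0, hcn] at this
  have hpop : surrRisk ℓ μ (fun x => clip (-s) s (f x)) ≤ ε / 2 + ℓ (-s) +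
      ∑ k ∈ Finset.range n, (ℓ (c (k + 1)) - ℓ (c k)) *
        μ.real (overThreshold f (c (k + 1))) := by
    have hcf : Measurable fun x => clip (-s) s (f x) :=
      measurable_const.max (measurable_const.min hf)
    have i1 := integrable_loss μ hℓ hcf fun x => abs_clip_le hs.le (f x)
    have i2 : ∀ k, Integrable ((overThreshold f (c (k + 1))).indicator
        (1 : X × Bool → ℝ)) μ := fun k =>
      (integrable_const 1).indicator (measurableSet_overThreshold hf _)
    have i3 := integrable_finsetSum (μ := μ) (Finset.range n) (fun k _ =>
      (i2 k).const_mul (ℓ (c (k + 1)) - ℓ (c k)))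
    have := integral_mono i1 ((integrable_const (ε / 2 + ℓ (-s))).add i3) (fun z => by
      have := (abs_le.1 (happrox z)).2
      rw [← sgn_mul_clip hs.le] at this
      simp only [Pi.add_apply]
      linarith)
    rw [integral_add' (integrable_const _) i3,
      integral_finsetSum _ fun k _ => (i2 k).const_mul _] at this
    simp only [integral_const_mul, integral_indicator_one (measurableSet_overThreshold hf _)]
      at this
    simpa [surrRisk] using this
  have hemp : (1 / (m : ℝ)) * ∑ i, (ℓ (-s) + ∑ k ∈ Finset.range n,
      (ℓ (c (k + 1)) - ℓ (c k)) * (overThreshold f (c (k + 1))).indicator 1 (S i)) ≤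
      (1 / (m : ℝ)) * ∑ i, ℓ (clip (-s) s (-(sgn (S i).2) * f (S i).1)) + ε / 2 := by
    rw [← average_const hm (ε / 2), ← mul_add, ← Finset.sum_add_distrib]
    refine average_le_average fun i => ?_
    have := (abs_le.1 (happrox (S i))).1
    linarith
  rw [Finset.sum_add_distrib, mul_add, average_const hm, Finset.sum_comm, Finset.mul_sum] at hemp
  have hdev : ∀ k, (ℓ (c (k + 1)) - ℓ (c k)) * ((1 / (m : ℝ)) *
      selDev μ (fun _ : Fin m → X × Bool => overThreshold f (c (k + 1))) S) =
      (1 / (m : ℝ)) * ∑ i, (ℓ (c (k + 1)) - ℓ (c k)) *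
        (overThreshold f (c (k + 1))).indicator 1 (S i) -
      (ℓ (c (k + 1)) - ℓ (c k)) * μ.real (overThreshold f (c (k + 1))) := by
    intro k
    rw [selDev, Finset.sum_sub_distrib, mul_sub, average_const hm, ← Finset.mul_sum]
    ring
  simp only [hdev, Finset.sum_sub_distrib]
  linarith

end Clip


/-! ### Measurability of the run, and consistency -/

section Measurability

variable {X : Type*} [MeasurableSpace X] {H : Set (X → ℝ)} {C : Choices X H}

lemma Choices.IsMeasurable.iterate (hC : C.IsMeasurable) (m t : ℕ) :
    Measurable fun p : (Fin m → X × Bool) × X => predictor H (C.iterate m p.1 t) p.2 := by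
  induction t with
  | zero => simp [Choices.iterate, predictor_zero]
  | succ t ih =>
    simp only [Choices.iterate, Choices.dir, predictor_add, predictor_smul, predictor_single]
    exact ih.add (((hC.step m t).comp measurable_fst).mul ((hC.weak m t).mul
      (measurable_sgn.comp ((hC.sign m t).comp measurable_fst))))

lemma Choices.IsMeasurable.output (hC : C.IsMeasurable) (m : ℕ) :
    Measurable fun p : (Fin m → X × Bool) × X => predictor H (C.output m p.1) p.2 := by
  have h : Measurable fun q : ℕ × ((Fin m → X × Bool) × X) =>
      predictor H (C.iterate m q.2.1 q.1) q.2.2 :=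
    measurable_from_prod_countable_right fun t => hC.iterate m t
  exact h.comp (((hC.best m).comp measurable_fst).prodMk measurable_id)

lemma measurableSet_overThreshold_selected {m : ℕ} {F : (Fin m → X × Bool) → X → ℝ}
    (hF : Measurable fun p : (Fin m → X × Bool) × X => F p.1 p.2) (c : ℝ) :
    MeasurableSet {q : (Fin m → X × Bool) × (X × Bool) | q.2 ∈ overThreshold (F q.1) c} := by
  have hmap : Measurable fun q : (Fin m → X × Bool) × (X × Bool) => ((q.1, q.2.1), q.2.2) := by
    fun_prop
  exact hmap (measurableSet_overThreshold hF c)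

end Measurability

section Consistency

variable {X : Type*} [MeasurableSpace X] {H : Set (X → ℝ)} {μ : Measure (X × Bool)}
  {Ω : Type*} [MeasurableSpace Ω] {P : Measure Ω}
  [IsProbabilityMeasure P] {Z : ℕ → Ω → X × Bool}

/-- The strong law of large numbers for the empirical surrogate risk of a fixed weighting. -/
lemma ae_tendsto_empLoss {ℓ : ℝ → ℝ} (hℓ : IsLbds ℓ) (hbin : IsBinary H)
    (hmeas : ∀ h ∈ H, Measurable h) (hZ : ∀ i, Measurable (Z i)) (hlaw : ∀ i, P.map (Z i) = μ)
    (hindep : iIndepFun Z P) (lam : H →₀ ℝ) :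
    ∀ᵐ ω ∂P, Tendsto (fun m : ℕ => empLoss H ℓ (fun i : Fin m => Z i ω) lam) atTop
      (𝓝 (surrRisk ℓ μ (predictor H lam))) := by
  have hpm := measurable_predictor hmeas lam
  obtain ⟨c, hc⟩ := exists_abs_predictor_le hbin lam
  have hφ : Measurable fun z => ℓ (negMargin H lam z) := measurable_loss hℓ hpm
  have hint : Integrable (fun ω => ℓ (negMargin H lam (Z 0 ω))) P := by
    refine Integrable.of_bound (hφ.comp (hZ 0)).aestronglyMeasurable (ℓ c) (ae_of_all _ fun ω => ?_)
    rw [Real.norm_eq_abs, abs_of_nonneg (hℓ.nonneg _)]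
    exact loss_le_of_abs_le hℓ _ (hc _)
  have hident : ∀ i, IdentDistrib (fun ω => ℓ (negMargin H lam (Z i ω)))
      (fun ω => ℓ (negMargin H lam (Z 0 ω))) P P := fun i =>
    (show IdentDistrib (Z i) (Z 0) P P from
      ⟨(hZ i).aemeasurable, (hZ 0).aemeasurable, by rw [hlaw, hlaw]⟩).comp hφ
  have hslln := strong_law_ae_real (fun i ω => ℓ (negMargin H lam (Z i ω))) hint
    (fun i j hij => (hindep.indepFun hij).comp hφ hφ) hident
  have hval : ∫ ω, ℓ (negMargin H lam (Z 0 ω)) ∂P = surrRisk ℓ μ (predictor H lam) := by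
    rw [surrRisk, ← hlaw 0, integral_map (hZ 0).aemeasurable
      (measurable_loss hℓ hpm).aestronglyMeasurable]
    rfl
  filter_upwards [hslln] with ω hω
  rw [hval] at hω
  refine hω.congr fun m => ?_
  rw [empLoss, Fin.sum_univ_eq_sum_range fun i => ℓ (negMargin H lam (Z i ω))]
  ring

/-- The normalized deviation of the misclassification event is the difference of the empirical
and the true classification risk. -/
lemma average_selDev_eq {m : ℕ} (hm : 1 ≤ m) (F : (Fin m → X × Bool) → X → ℝ)
    (S : Fin m → X × Bool) :
    (1 / (m : ℝ)) * selDev μ (fun S => overThreshold (F S) 0) S =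
      empErr S (F S) - risk μ (F S) := by
  rw [selDev, Finset.sum_sub_distrib, mul_sub, average_const hm]
  simp only [overThreshold_zero]
  unfold empErr risk
  congr 3

variable [IsProbabilityMeasure μ]

/-- The deviation of the frequency of a threshold event tends to zero for any measurable rule that
selects a combination of at most `⌈m ^ a⌉` members of a VC class. -/
lemma ae_tendsto_selDev_sparse (hbin : IsBinary H) (hvc : FiniteVC H) {a : ℝ} (ha0 : 0 < a)
    (ha1 : a < 1) (hZ : ∀ i, Measurable (Z i)) (hlaw : ∀ i, P.map (Z i) = μ)
    (hindep : iIndepFun Z P) {lam : (m : ℕ) → (Fin m → X × Bool) → (H →₀ ℝ)}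
    (hmeas : ∀ m, Measurable fun p : (Fin m → X × Bool) × X => predictor H (lam m p.1) p.2)
    (hcard : ∀ m, 1 ≤ m → ∀ S, (lam m S).support.card ≤ ⌈(m : ℝ) ^ a⌉₊) (c : ℝ) :
    ∀ᵐ ω ∂P, Tendsto (fun m : ℕ => (1 / (m : ℝ)) *
      selDev μ (fun S => overThreshold (predictor H (lam m S)) c) fun i : Fin m => Z i ω)
      atTop (𝓝 0) := by
  obtain ⟨d, hd⟩ := hvc
  refine ae_tendsto_selDev hZ hlaw hindep
    (D := fun m S => overThreshold (predictor H (lam m S)) c)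
    (𝓕 := fun m => {D | ∃ lam : H →₀ ℝ, lam.support.card ≤ ⌈(m : ℝ) ^ a⌉₊ ∧
      D = overThreshold (predictor H lam) c})
    (fun m => measurableSet_overThreshold_selected (F := fun S => predictor H (lam m S))
      (hmeas m) c)
    (N := fun m => ((2 * m + 1) ^ d + 1) ^ ⌈(m : ℝ) ^ a⌉₊ * (2 * m + 1) ^ (⌈(m : ℝ) ^ a⌉₊ + 1))
    (fun m _ => ?_) (fun m hm S => ⟨lam m S, hcard m hm S, rfl⟩)
    (fun ε hε => summable_traces_mul_exp ha0 ha1 d hε)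
  have := traceBound_overThreshold hbin hd ⌈(m : ℝ) ^ a⌉₊ c (Fin m × Bool)
  simpa [mul_comm m 2] using this

end Consistency

end Boosting

open Boosting in
theorem mainTheorem1 {X : Type*} [MeasurableSpace X]
    (ℓ : ℝ → ℝ) (hbds : Boosting.IsLbds ℓ) (htd : Boosting.IsLtd ℓ)
    (μ : Measure (X × Bool)) [IsProbabilityMeasure μ]
    (H : Set (X → ℝ)) (hbin : Boosting.IsBinary H) (hmeas : ∀ h ∈ H, Measurable h)
    (hvc : Boosting.FiniteVC H) (hds : Boosting.DenseSpan (μ.map Prod.fst) H)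
    (a : ℝ) (ha0 : 0 < a) (ha1 : a < 1)
    (ρ : ℝ) (hρ0 : 0 < ρ) (hρ1 : ρ < 1)
    (C : Boosting.Choices X H) (hC : C.IsMeasurable)
    (hrun : ∀ (m : ℕ), 1 ≤ m → ∀ S : Fin m → X × Bool, C.IsRun ℓ ρ ⌈(m : ℝ) ^ a⌉₊ m S)
    {Ω : Type*} [MeasurableSpace Ω] (P : Measure Ω) [IsProbabilityMeasure P]
    (Z : ℕ → Ω → X × Bool) (hZ : ∀ i, Measurable (Z i)) (hlaw : ∀ i, P.map (Z i) = μ)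
    (hindep : iIndepFun Z P) :
    ∀ᵐ ω ∂P, Tendsto
      (fun m : ℕ => Boosting.risk μ
        (Boosting.predictor H (C.output m (fun i : Fin m => Z i ω))))
      atTop (𝓝 (Boosting.bayesRisk μ)) := by
  set T : ℕ → ℕ := fun m => ⌈(m : ℝ) ^ a⌉₊ with hT
  have hTpos : ∀ m : ℕ, 1 ≤ m → 1 ≤ T m := fun m hm =>
    Nat.one_le_iff_ne_zero.2 (Nat.ceil_pos.2 (by positivity)).ne'
  have hTlim : Tendsto T atTop atTop :=
    tendsto_nat_ceil_atTop.comp ((tendsto_rpow_atTop ha0).comp tendsto_natCast_atTop_atTop)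
  have hupper : ∀ ε : ℝ, 0 < ε → ∀ᵐ ω ∂P, ∀ᶠ m : ℕ in atTop,
      risk μ (predictor H (C.output m fun i : Fin m => Z i ω)) ≤ bayesRisk μ + 3 * ε := by
    intro ε hε
    -- The tolerance `δ` for the surrogate risk is used up by the choice of the competitor, by
    -- clipping, by the staircase approximation and its deviations, by the law of large numbers for
    -- the competitor, and by the optimization error.
    obtain ⟨δ, hδ, hcal⟩ := exists_calibration μ hbds htd hε
    obtain ⟨lamBar, hopt⟩ := exists_near_optimal μ hbds hbin hmeas hds
      (show 0 < δ / 5 by positivity)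
    obtain ⟨s, hs, hclip⟩ := hbds.exists_clip_le (show 0 < δ / 5 by positivity)
    obtain ⟨n, c, w, hthr⟩ := exists_thresholds μ hbds hs (show 0 < δ / 10 by positivity)
    obtain ⟨T₀, hT₀⟩ := exists_rounds hbds htd hbin hρ0 hε (show 0 < δ / 5 by positivity) lamBar
    have hdev := fun c : ℝ => ae_tendsto_selDev_sparse hbin hvc ha0 ha1 hZ hlaw hindep
      (lam := fun m S => C.iterate m S (T m)) (fun m => hC.iterate m (T m))
      (fun m _ S => C.card_support_iterate_le S _) c
    have hout := ae_tendsto_selDev_sparse hbin hvc ha0 ha1 hZ hlaw hindep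
      (lam := fun m S => C.output m S) (fun m => hC.output m)
      (fun m hm S => (C.card_support_iterate_le S _).trans (hrun m hm S).best_le) 0
    filter_upwards [hout, hdev 0, ae_all_iff.2 fun k => hdev (c k),
      ae_tendsto_empLoss hbds hbin hmeas hZ hlaw hindep lamBar] with ω h1 h2 h3 h4
    have h5 : Tendsto (fun m : ℕ => ∑ k ∈ Finset.range n, w k * ((1 / (m : ℝ)) *
        selDev μ (fun S => overThreshold (predictor H (C.iterate m S (T m))) (c k))
          fun i : Fin m => Z i ω)) atTop (𝓝 0) := by
      have := tendsto_finsetSum (Finset.range n) fun k _ => (h3 k).const_mul (w k)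
      simpa using this
    filter_upwards [h1.eventually_const_le (show -ε < 0 by linarith),
      h2.eventually_le_const hε,
      h5.eventually_const_le (show -(δ / 10) < 0 by linarith),
      h4.eventually_le_const (show _ < surrRisk ℓ μ (predictor H lamBar) + δ / 5 by linarith),
      hTlim.eventually_ge_atTop T₀, eventually_ge_atTop 1] with m e1 e2 e3 e4 e5 hm
    set S : Fin m → X × Bool := fun i => Z i ω with hS
    rw [average_selDev_eq hm (fun S => predictor H (C.output m S))] at e1
    rw [average_selDev_eq hm (fun S => predictor H (C.iterate m S (T m)))] at e2
    have hr := hrun m hm S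
    -- In either case the error of the output is compared with that of some iterate on the sample.
    rcases hT₀ (T m) e5 C m S hm hr with ⟨t, ht1, htT, hterr⟩ | hloss
    · have h6 := hr.best_min t ht1 htT
      have h7 : 0 ≤ bayesRisk μ := Real.iInf_nonneg fun _ => measureReal_nonneg
      linarith
    · -- The last iterate is nearly optimal for the surrogate risk, after clipping.
      have hfm := measurable_predictor hmeas (C.iterate m S (T m))
      have h6 := hr.best_min (T m) (hTpos m hm) le_rfl
      have h7 := hthr _ hfm m hm S
      have h8 : (1 / (m : ℝ)) * ∑ i, ℓ (clip (-s) s (-(sgn (S i).2) *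
          predictor H (C.iterate m S (T m)) (S i).1)) ≤
          empLoss H ℓ S (C.iterate m S (T m)) + δ / 5 := by
        rw [empLoss, ← average_const hm (δ / 5), ← mul_add, ← Finset.sum_add_distrib]
        exact average_le_average fun i => hclip _
      simp only [selDev_eq_const μ (fun S => overThreshold (predictor H (C.iterate m S (T m))) _)]
        at e3
      have h10 := hcal (fun x => clip (-s) s (predictor H (C.iterate m S (T m)) x))
        (measurable_const.max (measurable_const.min hfm)) ⟨s, fun x => abs_clip_le hs.le _⟩
        fun f' hf' hb' => by
          have := hopt f' hf' hb'
          linarith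
      have h11 : risk μ (fun x => clip (-s) s (predictor H (C.iterate m S (T m)) x)) =
          risk μ (predictor H (C.iterate m S (T m))) := by
        unfold risk
        congr 1
        ext z
        exact errs_clip hs _ z
      rw [h11] at h10
      linarith
  have hall : ∀ᵐ ω ∂P, ∀ k : ℕ, ∀ᶠ m : ℕ in atTop,
      risk μ (predictor H (C.output m fun i : Fin m => Z i ω)) ≤
        bayesRisk μ + 3 * (1 / ((k : ℝ) + 1)) :=
    ae_all_iff.2 fun k => hupper _ (by positivity)
  filter_upwards [hall] with ω hω
  refine tendsto_order.2 ⟨fun r hr => Eventually.of_forall fun m => hr.trans_le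
    (bayesRisk_le_risk μ (measurable_predictor hmeas _)), fun r hr => ?_⟩
  obtain ⟨k, hk⟩ := exists_nat_one_div_lt (show 0 < (r - bayesRisk μ) / 3 by linarith)
  filter_upwards [hω k] with m hm
  linarith
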